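/- Let $m>p\ge 1$ be integers and let $\mathbf Z$ be a random $m\times p$ complex matrix whose entries $z_{ij}$ are independent with $z_{ij}\sim\mathbb{C}N(\xi_{ij},1)$, that is, $z_{ij}$ has density $\pi^{-1}\exp(-|z-\xi_{ij}|^2)$ with respect to Lebesgue measure on $\mathbb C$; the mean matrix $\mathbf\Xi=(\xi_{ij})\in\mathbb C^{m\times p}$ is unknown. An estimator $\widehat{\mathbf\Xi}=\widehat{\mathbf\Xi}(\mathbf Z)$ of $\mathbf\Xi$ has risk $$R_0(\widehat{\mathbf\Xi},\mathbf\Xi)=\mathbb E\big[\mathrm{Tr}\{(\widehat{\mathbf\Xi}-\mathbf\Xi)^*(\widehat{\mathbf\Xi}-\mathbf\Xi)\}\big]\in[0,\infty],$$ and it is called minimax if $\sup_{\mathbf\Xi}R_0(\widehat{\mathbf\Xi},\mathbf\Xi)\le\sup_{\mathbf\Xi}R_0(\widehat{\mathbf\Xi}',\mathbf\Xi)$ for every estimator $\widehat{\mathbf\Xi}'$. Write $\mathbf Z^*\mathbf Z=\mathbf U\,\mathrm{Diag}(\ell_1,\dots,\ell_p)\,\mathbf U^*$ with $\mathbf U$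 a $p\times p$ unitary matrix and $\ell_1\ge\ell_2\ge\cdots\ge\ell_p$ (with probability one, $\ell_1>\cdots>\ell_p>0$), and let $$\widehat{\mathbf\Xi}_H=\mathbf Z\,[\mathbf I_p+\mathbf U\,\mathrm{Diag}(h_1,\dots,h_p)\,\mathbf U^*],\qquad h_k=-\frac{m+p-2k}{\ell_k}\quad(k=1,\dots,p).$$ Then $\widehat{\mathbf\Xi}_H$ is minimax, and moreover $R_0(\widehat{\mathbf\Xi}_H,\mathbf\Xi)<R_0(\mathbf Z,\mathbf\Xi)$ for every $\mathbf\Xi\in\mathbb C^{m\times p}$. -/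

import Mathlib

open MeasureTheory
open scoped Matrix ENNReal

noncomputable section

/-- The product (equivalently, Borel) σ-algebra on matrices. -/
instance matrixMeasurableSpace {m p : ℕ} : MeasurableSpace (Matrix (Fin m) (Fin p) ℂ) :=
  inferInstanceAs (MeasurableSpace (Fin m → Fin p → ℂ))

/-- The univariate complex normal distribution `ℂN(ξ, 1)`: the measure on `ℂ` with density
`π⁻¹ exp (-|z - ξ|²)` with respect to Lebesgue measure. -/
def complexNormal (ξ : ℂ) : Measure ℂ :=
  volume.withDensity fun z => ENNReal.ofReal (Real.pi⁻¹ * Real.exp (-‖z - ξ‖ ^ 2))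

/-- The matrix-variate complex normal distribution `ℂN_{m × p}(Ξ, I_m ⊗ I_p)`: the law of a random
`m × p` matrix whose entries `z_ij` are independent with `z_ij ∼ ℂN(ξ_ij, 1)`. -/
def matrixComplexNormal {m p : ℕ} (Ξ : Matrix (Fin m) (Fin p) ℂ) :
    Measure (Matrix (Fin m) (Fin p) ℂ) :=
  (Measure.pi fun i => Measure.pi fun j => complexNormal (Ξ i j)).map
    (Matrix.of : (Fin m → Fin p → ℂ) → Matrix (Fin m) (Fin p) ℂ)

/-- The loss `Tr {(A - Ξ)^* (A - Ξ)}` (this trace is a nonnegative real number). -/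
def quadLoss {m p : ℕ} (A Ξ : Matrix (Fin m) (Fin p) ℂ) : ℝ :=
  (Matrix.trace ((A - Ξ)ᴴ * (A - Ξ))).re

/-- The risk `E [Tr {(δ(Z) - Ξ)^* (δ(Z) - Ξ)}]`, `Z ∼ ℂN_{m × p}(Ξ, I_m ⊗ I_p)`,
with values in `[0, ∞]`. -/
def risk {m p : ℕ} (δ : Matrix (Fin m) (Fin p) ℂ → Matrix (Fin m) (Fin p) ℂ)
    (Ξ : Matrix (Fin m) (Fin p) ℂ) : ℝ≥0∞ :=
  ∫⁻ z, ENNReal.ofReal (quadLoss (δ z) Ξ) ∂(matrixComplexNormal Ξ)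

/-- An estimator of `Ξ` based on `Z`: a function of `Z` that is measurable up to null sets of
the laws in the model. -/
def IsEstimator {m p : ℕ} (δ : Matrix (Fin m) (Fin p) ℂ → Matrix (Fin m) (Fin p) ℂ) : Prop :=
  ∀ Ξ : Matrix (Fin m) (Fin p) ℂ, AEMeasurable δ (matrixComplexNormal Ξ)

/-- A minimax estimator: its maximal risk is the least possible among all estimators. -/
def IsMinimax {m p : ℕ} (δ : Matrix (Fin m) (Fin p) ℂ → Matrix (Fin m) (Fin p) ℂ) : Prop :=
  IsEstimator δ ∧
    ∀ δ' : Matrix (Fin m) (Fin p) ℂ → Matrix (Fin m) (Fin p) ℂ, IsEstimator δ' →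
      (⨆ Ξ, risk δ Ξ) ≤ ⨆ Ξ, risk δ' Ξ

/-- `W = U L U^*` with `U` unitary and `L = Diag(ℓ_1, …, ℓ_p)`, `ℓ_1 ≥ ℓ_2 ≥ ⋯ ≥ ℓ_p`. -/
structure IsOrderedSpectralDecomposition {p : ℕ} (W U : Matrix (Fin p) (Fin p) ℂ)
    (ℓ : Fin p → ℝ) : Prop where
  unitary : U ∈ Matrix.unitaryGroup (Fin p) ℂ
  antitone : Antitone ℓ
  eq : W = U * Matrix.diagonal (fun k => (ℓ k : ℂ)) * Uᴴ

/-- The estimator `Z [I_p + U H(L) U^*]`, `H(L) = Diag(h_1(L), …, h_p(L))`, where `U` and `ℓ` are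
given as functions of `Z`. -/
def shrinkageEstimator {m p : ℕ} (h : (Fin p → ℝ) → Fin p → ℝ)
    (U : Matrix (Fin m) (Fin p) ℂ → Matrix (Fin p) (Fin p) ℂ)
    (ℓ : Matrix (Fin m) (Fin p) ℂ → Fin p → ℝ) (z : Matrix (Fin m) (Fin p) ℂ) :
    Matrix (Fin m) (Fin p) ℂ :=
  z * (1 + U z * Matrix.diagonal (fun k => (h (ℓ z) k : ℂ)) * (U z)ᴴ)

/-- `h_k(L) = -(m + p - 2k) / ℓ_k` for `k = 1, …, p`; the index `k : Fin p` starts at `0`. -/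
def shrinkageWeight (m p : ℕ) (ℓ : Fin p → ℝ) (k : Fin p) : ℝ :=
  -((m : ℝ) + (p : ℝ) - 2 * ((k : ℕ) + 1 : ℝ)) / ℓ k

end

/-! The estimator `Z` has constant risk `m * p`, and `m * p` is also a lower bound for the maximal
risk of any estimator. Under the prior with independent `ℂN(0, τ)` entries, the posterior of `Ξ` is
Gaussian with variance `τ / (1 + τ)` per entry, so the Bayes risk is at least `m * p * τ / (1 + τ)`,
and `τ → ∞` gives `mul_le_iSup_risk`. Both claims therefore follow once the shrinkage estimator has
risk strictly below `m * p` at every `Ξ`.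

For this, write the estimator as `Z + G` and use Stein's identity. The density is `exp (-|z - Ξ|²)`
up to a constant, so `2 E⟨Z - Ξ, G⟩ = E div G` with the divergence in the `2mp` real coordinates,
and the risk is `m * p + E (‖G‖² + div G)`. With zero-based indices put `c_k = m + p - 2(k + 1)`, so
that `G = -Z U Diag(c_k / ℓ_k) U^*`. First-order perturbation theory gives `‖G‖² + div G = ∑ (c_k² -
2(m - p) c_k) / ℓ_k - 2 ∑_{j,k} (c_j - c_k) / (ℓ_j - ℓ_k)`, where diagonal terms of the double sum
are zero. For `j < k` the quotient is at least `2(k - j) / ℓ_j`. Summing, the coefficient of `1 /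
ℓ_k` becomes `-((m - p)² + 4(p - 1 - k)) ≤ -1`. Hence the expression is negative, which is
`weight_inequality`.

`G` is singular where eigenvalues collide or vanish, so it is multiplied by a compactly supported
`C¹` cutoff `η_r(ℓ)` that vanishes near the bad set. The cutoff adds `dη_r` applied to the velocity
of `ℓ` along `G`, and this velocity is exactly `-2c`. As `c` is nonnegative and decreasing, motion
along `-c` shrinks every eigenvalue and every gap, so the part of the cutoff guarding the
singularities contributes a nonpositive term. Only the cutoff at infinity costs anything, and its
cost is `O(1 / r)` (`fderiv_cutoff_neg_le`). Fatou's lemma removes the cutoff, and the retained gain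
`1 / (1 + ‖z‖²)` makes the inequality strict.

The maps `U` and `ℓ` are arbitrary choices of a decomposition. Their regularity comes from
perturbation bounds: `ℓ` is continuous, and the spectral projections are continuous wherever the
spectrum is simple and positive, which holds almost everywhere (`ae_isSimplePos`). -/

noncomputable section

/-! ### Gaussian densities, their first moments, and the constant risk of `Z`. -/

section GaussianDensity

lemma withDensity_ofReal_apply_eq {X : Type*} [MeasurableSpace X] {μ : Measure X}
    {f : X → ℝ} (hf : Integrable f μ) (h0 : ∀ x, 0 ≤ f x) {s : Set X} (hs : MeasurableSet s) :
    μ.withDensity (fun x => ENNReal.ofReal (f x)) s = ENNReal.ofReal (∫ x, s.indicator f x ∂μ) := by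
  rw [withDensity_apply _ hs, integral_indicator hs,
    ofReal_integral_eq_lintegral_ofReal hf.integrableOn (.of_forall h0)]

/-- A product of measures with integrable densities has the product density. -/
lemma pi_withDensity_ofReal {ι : Type*} [Fintype ι] {X : ι → Type*} [∀ i, MeasureSpace (X i)]
    [∀ i, SigmaFinite (volume : Measure (X i))] (f : ∀ i, X i → ℝ)
    (hf : ∀ i, Integrable (f i)) (h0 : ∀ i x, 0 ≤ f i x) :
    Measure.pi (fun i => volume.withDensity fun x => ENNReal.ofReal (f i x)) =
      (volume : Measure (∀ i, X i)).withDensity fun x => ENNReal.ofReal (∏ i, f i (x i)) := by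
  have : ∀ i, IsFiniteMeasure (volume.withDensity fun x => ENNReal.ofReal (f i x)) := fun i =>
    isFiniteMeasure_withDensity_ofReal (hf i).2
  refine Measure.pi_eq fun s hs => ?_
  rw [withDensity_ofReal_apply_eq (μ := (volume : Measure (∀ i, X i)))
    (f := fun x => ∏ i, f i (x i)) (Integrable.fintype_prod_dep hf)
    (fun x => Finset.prod_nonneg fun i _ => h0 i (x i)) (MeasurableSet.univ_pi hs)]
  have h1 : (fun x : ∀ i, X i => (Set.univ.pi s).indicator (fun x => ∏ i, f i (x i)) x) =
      fun x => ∏ i, (s i).indicator (f i) (x i) := by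
    funext x
    by_cases hx : x ∈ Set.univ.pi s
    · rw [Set.indicator_of_mem hx]
      exact Finset.prod_congr rfl fun i _ => (Set.indicator_of_mem (hx i trivial) _).symm
    · rw [Set.indicator_of_notMem hx]
      simp only [Set.mem_univ_pi, not_forall] at hx
      obtain ⟨i, hi⟩ := hx
      exact (Finset.prod_eq_zero (Finset.mem_univ i) (Set.indicator_of_notMem hi _)).symm
  rw [h1, integral_fintype_prod_volume_eq_prod (f := fun i => (s i).indicator (f i)),
    ENNReal.ofReal_prod_of_nonneg fun i _ => integral_nonneg fun x =>
      Set.indicator_nonneg (fun x _ => h0 i x) x]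
  exact Finset.prod_congr rfl fun i _ => (withDensity_ofReal_apply_eq (hf i) (h0 i) (hs i)).symm

/-- The density of the complex normal distribution with mean `ξ` and variance `s`. -/
def complexGaussianPDF (s : ℝ) (ξ z : ℂ) : ℝ := (Real.pi * s)⁻¹ * Real.exp (-‖z - ξ‖ ^ 2 / s)

lemma complexGaussianPDF_nonneg {s : ℝ} (hs : 0 < s) (ξ z : ℂ) : 0 ≤ complexGaussianPDF s ξ z := by
  unfold complexGaussianPDF; positivity

lemma continuous_complexGaussianPDF (s : ℝ) (ξ : ℂ) : Continuous (complexGaussianPDF s ξ) := by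
  unfold complexGaussianPDF; fun_prop

lemma integral_complexGaussianPDF {s : ℝ} (hs : 0 < s) (ξ : ℂ) :
    ∫ z, complexGaussianPDF s ξ z = 1 := by
  have h := Complex.integral_rpow_mul_exp_neg_mul_rpow (p := 2) (q := 0) (b := s⁻¹)
    (by norm_num) (by norm_num) (by positivity)
  have h2 : (fun z : ℂ => complexGaussianPDF s 0 z) = fun z =>
      (Real.pi * s)⁻¹ * (‖z‖ ^ (0 : ℝ) * Real.exp (-s⁻¹ * ‖z‖ ^ (2 : ℝ))) := by
    funext z
    simp [complexGaussianPDF, div_eq_inv_mul]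
  have h3 : ∫ z, complexGaussianPDF s ξ z = ∫ z, complexGaussianPDF s 0 z := by
    rw [← integral_sub_right_eq_self (fun z => complexGaussianPDF s 0 z) ξ]
    simp [complexGaussianPDF]
  rw [h3, h2, integral_const_mul, h]
  have : (-(0 + 2) / 2 : ℝ) = -1 := by norm_num
  rw [this, Real.rpow_neg_one]
  have : ((0 + 2) / 2 : ℝ) = 1 := by norm_num
  rw [this, Real.Gamma_one]
  have := Real.pi_pos
  field_simp

lemma integral_sq_mul_complexGaussianPDF {s : ℝ} (hs : 0 < s) (ξ : ℂ) :
    ∫ z, ‖z - ξ‖ ^ 2 * complexGaussianPDF s ξ z = s := by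
  have h := Complex.integral_rpow_mul_exp_neg_mul_rpow (p := 2) (q := 2) (b := s⁻¹)
    (by norm_num) (by norm_num) (by positivity)
  have h2 : (fun z : ℂ => ‖z‖ ^ 2 * complexGaussianPDF s 0 z) = fun z =>
      (Real.pi * s)⁻¹ * (‖z‖ ^ (2 : ℝ) * Real.exp (-s⁻¹ * ‖z‖ ^ (2 : ℝ))) := by
    funext z
    simp [complexGaussianPDF, div_eq_inv_mul]
    ring
  have h3 : ∫ z, ‖z - ξ‖ ^ 2 * complexGaussianPDF s ξ z =
      ∫ z, ‖z‖ ^ 2 * complexGaussianPDF s 0 z := by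
    rw [← integral_sub_right_eq_self (fun z => ‖z‖ ^ 2 * complexGaussianPDF s 0 z) ξ]
    simp [complexGaussianPDF]
  rw [h3, h2, integral_const_mul, h]
  have : (-(2 + 2) / 2 : ℝ) = -2 := by norm_num
  rw [this, Real.rpow_neg (by positivity), Real.rpow_two]
  have : ((2 + 2) / 2 : ℝ) = 2 := by norm_num
  rw [this, Real.Gamma_two]
  have := Real.pi_pos
  field_simp

lemma integrable_complexGaussianPDF {s : ℝ} (hs : 0 < s) (ξ : ℂ) :
    Integrable (complexGaussianPDF s ξ) :=
  .of_integral_ne_zero (by rw [integral_complexGaussianPDF hs]; exact one_ne_zero)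

lemma integrable_sq_mul_complexGaussianPDF {s : ℝ} (hs : 0 < s) (ξ : ℂ) :
    Integrable (fun z => ‖z - ξ‖ ^ 2 * complexGaussianPDF s ξ z) :=
  .of_integral_ne_zero (by rw [integral_sq_mul_complexGaussianPDF hs]; exact hs.ne')

variable {m p : ℕ}

/-- The density of a matrix of independent complex normal entries with common variance `s`. -/
def matrixGaussianPDF (s : ℝ) (Ξ z : Fin m → Fin p → ℂ) : ℝ :=
  ∏ i, ∏ j, complexGaussianPDF s (Ξ i j) (z i j)

instance isAddHaarMeasure_volume_matrix (m p : ℕ) :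
    (volume : Measure (Fin m → Fin p → ℂ)).IsAddHaarMeasure :=
  Measure.pi.isAddHaarMeasure fun _ : Fin m => (volume : Measure (Fin p → ℂ))

instance isNegInvariant_volume_matrix (m p : ℕ) :
    (volume : Measure (Fin m → Fin p → ℂ)).IsNegInvariant :=
  Measure.pi.isNegInvariant fun _ : Fin m => (volume : Measure (Fin p → ℂ))

/-- The squared Frobenius norm. -/
def sqNorm (z : Fin m → Fin p → ℂ) : ℝ := ∑ i, ∑ j, ‖z i j‖ ^ 2

lemma sqNorm_nonneg (z : Fin m → Fin p → ℂ) : 0 ≤ sqNorm z := by unfold sqNorm; positivity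

lemma continuous_sqNorm : Continuous (sqNorm : (Fin m → Fin p → ℂ) → ℝ) := by
  unfold sqNorm; fun_prop

lemma continuous_matrixGaussianPDF (s : ℝ) (Ξ : Fin m → Fin p → ℂ) :
    Continuous (matrixGaussianPDF s Ξ) :=
  continuous_finsetProd _ fun i _ => continuous_finsetProd _ fun j _ =>
    (continuous_complexGaussianPDF s _).comp (by fun_prop)

lemma matrixGaussianPDF_nonneg {s : ℝ} (hs : 0 < s) (Ξ z : Fin m → Fin p → ℂ) :
    0 ≤ matrixGaussianPDF s Ξ z :=
  Finset.prod_nonneg fun _ _ => Finset.prod_nonneg fun _ _ => complexGaussianPDF_nonneg hs _ _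

lemma matrixGaussianPDF_eq (s : ℝ) (Ξ z : Fin m → Fin p → ℂ) :
    matrixGaussianPDF s Ξ z = (Real.pi * s)⁻¹ ^ (m * p) * Real.exp (-sqNorm (z - Ξ) / s) := by
  simp only [matrixGaussianPDF, complexGaussianPDF, Finset.prod_mul_distrib, ← Real.exp_sum,
    Finset.prod_const, Finset.card_univ, Fintype.card_fin, sqNorm, Pi.sub_apply]
  rw [← pow_mul, mul_comm p m]
  congr 2
  simp only [neg_div, Finset.sum_neg_distrib, ← Finset.sum_div]

/-- The law of a matrix of independent complex normal entries with common variance `s`. -/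
def matrixGaussian (s : ℝ) (Ξ : Fin m → Fin p → ℂ) : Measure (Fin m → Fin p → ℂ) :=
  volume.withDensity fun z => ENNReal.ofReal (matrixGaussianPDF s Ξ z)

lemma matrixGaussian_eq_pi {s : ℝ} (hs : 0 < s) (Ξ : Fin m → Fin p → ℂ) :
    matrixGaussian s Ξ = Measure.pi fun i => Measure.pi fun j =>
      volume.withDensity fun z => ENNReal.ofReal (complexGaussianPDF s (Ξ i j) z) := by
  have h1 : ∀ i, (Measure.pi fun j =>
      volume.withDensity fun z => ENNReal.ofReal (complexGaussianPDF s (Ξ i j) z)) =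
      (volume : Measure (Fin p → ℂ)).withDensity
        fun x => ENNReal.ofReal (∏ j, complexGaussianPDF s (Ξ i j) (x j)) := fun i =>
    pi_withDensity_ofReal _ (fun j => integrable_complexGaussianPDF hs _)
      fun j => complexGaussianPDF_nonneg hs _
  simp_rw [h1]
  exact (pi_withDensity_ofReal (X := fun _ : Fin m => Fin p → ℂ)
    (fun i x => ∏ j, complexGaussianPDF s (Ξ i j) (x j))
    (fun i => Integrable.fintype_prod fun j => integrable_complexGaussianPDF hs _)
    fun i x => Finset.prod_nonneg fun j _ => complexGaussianPDF_nonneg hs _ _).symm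

lemma isProbabilityMeasure_complexGaussian {s : ℝ} (hs : 0 < s) (ξ : ℂ) :
    IsProbabilityMeasure
      (volume.withDensity fun z => ENNReal.ofReal (complexGaussianPDF s ξ z)) := by
  constructor
  rw [withDensity_apply _ .univ, Measure.restrict_univ,
    ← ofReal_integral_eq_lintegral_ofReal (integrable_complexGaussianPDF hs ξ)
    (.of_forall (complexGaussianPDF_nonneg hs ξ)), integral_complexGaussianPDF hs,
    ENNReal.ofReal_one]

lemma isProbabilityMeasure_matrixGaussian {s : ℝ} (hs : 0 < s) (Ξ : Fin m → Fin p → ℂ) :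
    IsProbabilityMeasure (matrixGaussian s Ξ) := by
  have := fun ξ => isProbabilityMeasure_complexGaussian hs ξ
  rw [matrixGaussian_eq_pi hs]
  infer_instance

lemma lintegral_sqNorm_matrixGaussian {s : ℝ} (hs : 0 < s) (Ξ : Fin m → Fin p → ℂ) :
    ∫⁻ z, ENNReal.ofReal (sqNorm (z - Ξ)) ∂matrixGaussian s Ξ = ENNReal.ofReal (m * p * s) := by
  have hprob := fun ξ => isProbabilityMeasure_complexGaussian hs ξ
  have key : ∀ i j, ∫⁻ z, ENNReal.ofReal (‖z i j - Ξ i j‖ ^ 2) ∂matrixGaussian s Ξ =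
      ENNReal.ofReal s := by
    intro i j
    rw [matrixGaussian_eq_pi hs]
    have h1 := (measurePreserving_eval (fun j => volume.withDensity fun z =>
      ENNReal.ofReal (complexGaussianPDF s (Ξ i j) z)) j).comp
      (measurePreserving_eval (fun i => Measure.pi fun j => volume.withDensity fun z =>
      ENNReal.ofReal (complexGaussianPDF s (Ξ i j) z)) i)
    have h2 := h1.lintegral_comp (f := fun w : ℂ => ENNReal.ofReal (‖w - Ξ i j‖ ^ 2))
      (by fun_prop)
    simp only [Function.comp_apply, Function.eval] at h2
    rw [h2, lintegral_withDensity_eq_lintegral_mul _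
      (continuous_complexGaussianPDF s _).measurable.ennreal_ofReal (by fun_prop)]
    simp only [Pi.mul_apply]
    have h3 : ∀ z, ENNReal.ofReal (complexGaussianPDF s (Ξ i j) z) *
        ENNReal.ofReal (‖z - Ξ i j‖ ^ 2) =
        ENNReal.ofReal (‖z - Ξ i j‖ ^ 2 * complexGaussianPDF s (Ξ i j) z) := fun z => by
      rw [mul_comm, ← ENNReal.ofReal_mul (by positivity)]
    simp_rw [h3]
    rw [← ofReal_integral_eq_lintegral_ofReal (integrable_sq_mul_complexGaussianPDF hs _)
      (.of_forall fun z => mul_nonneg (by positivity) (complexGaussianPDF_nonneg hs _ _)),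
      integral_sq_mul_complexGaussianPDF hs]
  have h4 : ∀ z, ENNReal.ofReal (sqNorm (z - Ξ)) =
      ∑ i, ∑ j, ENNReal.ofReal (‖z i j - Ξ i j‖ ^ 2) := fun z => by
    rw [sqNorm, ENNReal.ofReal_sum_of_nonneg fun i _ => by positivity]
    exact Finset.sum_congr rfl fun i _ => ENNReal.ofReal_sum_of_nonneg fun i _ => by positivity
  simp_rw [h4]
  rw [lintegral_finsetSum _ fun i _ => by fun_prop]
  have h5 : ∀ i, ∫⁻ z, ∑ j, ENNReal.ofReal (‖z i j - Ξ i j‖ ^ 2) ∂matrixGaussian s Ξ =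
      ∑ _j : Fin p, ENNReal.ofReal s := fun i => by
    rw [lintegral_finsetSum _ fun j _ => by fun_prop]
    exact Finset.sum_congr rfl fun j _ => key i j
  simp_rw [h5]
  simp only [Finset.sum_const, Finset.card_univ, Fintype.card_fin, nsmul_eq_mul]
  rw [ENNReal.ofReal_mul (by positivity), ENNReal.ofReal_mul (by positivity),
    ENNReal.ofReal_natCast, ENNReal.ofReal_natCast, mul_assoc]

lemma complexNormal_eq (ξ : ℂ) :
    complexNormal ξ = volume.withDensity fun z => ENNReal.ofReal (complexGaussianPDF 1 ξ z) := by
  simp [complexNormal, complexGaussianPDF]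

lemma matrixComplexNormal_eq (Ξ : Matrix (Fin m) (Fin p) ℂ) :
    matrixComplexNormal Ξ = matrixGaussian 1 Ξ := by
  -- `Matrix.of` is definitionally the identity, so the pushforward in `matrixComplexNormal` changes
  -- nothing.
  refine Measure.map_id.trans ?_
  simp_rw [complexNormal_eq]
  exact (matrixGaussian_eq_pi one_pos Ξ).symm

lemma quadLoss_eq (A Ξ : Matrix (Fin m) (Fin p) ℂ) : quadLoss A Ξ = sqNorm (A - Ξ) := by
  simp only [quadLoss, sqNorm, Matrix.trace, Matrix.diag_apply, Matrix.mul_apply,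
    Matrix.conjTranspose_apply, Complex.re_sum]
  rw [Finset.sum_comm]
  refine Finset.sum_congr rfl fun i _ => Finset.sum_congr rfl fun j _ => ?_
  rw [← Complex.normSq_eq_norm_sq, Complex.star_def, ← Complex.normSq_eq_conj_mul_self,
    Complex.ofReal_re]

lemma risk_eq (δ : Matrix (Fin m) (Fin p) ℂ → Matrix (Fin m) (Fin p) ℂ)
    (Ξ : Matrix (Fin m) (Fin p) ℂ) :
    risk δ Ξ = ∫⁻ z, ENNReal.ofReal (sqNorm (δ z - Ξ)) ∂matrixGaussian 1 Ξ := by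
  simp only [risk, matrixComplexNormal_eq, quadLoss_eq]
  rfl

lemma risk_id (Ξ : Matrix (Fin m) (Fin p) ℂ) : risk (fun z => z) Ξ = ENNReal.ofReal (m * p) := by
  rw [risk_eq, ← mul_one ((m : ℝ) * p)]
  exact lintegral_sqNorm_matrixGaussian one_pos Ξ

end GaussianDensity

/-! ### Lower bound `m * p` for the maximal risk, by Gaussian priors. -/

section BayesLowerBound

variable {m p : ℕ}

lemma volume_absolutelyContinuous_matrixGaussian {s : ℝ} (hs : 0 < s) (Ξ : Fin m → Fin p → ℂ) :
    (volume : Measure (Fin m → Fin p → ℂ)) ≪ matrixGaussian s Ξ := by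
  refine withDensity_absolutelyContinuous'
    (continuous_matrixGaussianPDF s Ξ).measurable.ennreal_ofReal.aemeasurable (.of_forall ?_)
  intro z
  rw [Ne, ENNReal.ofReal_eq_zero, not_le, matrixGaussianPDF_eq]
  have := Real.pi_pos
  positivity

lemma matrixGaussian_absolutelyContinuous_volume (s : ℝ) (Ξ : Fin m → Fin p → ℂ) :
    matrixGaussian s Ξ ≪ (volume : Measure (Fin m → Fin p → ℂ)) :=
  withDensity_absolutelyContinuous _ _

/-- All laws in the model are mutually absolutely continuous with Lebesgue measure, so a single
null-set condition suffices. -/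
lemma isEstimator_iff (δ : Matrix (Fin m) (Fin p) ℂ → Matrix (Fin m) (Fin p) ℂ) :
    IsEstimator δ ↔
      @AEMeasurable (Fin m → Fin p → ℂ) (Fin m → Fin p → ℂ) _ _ δ volume := by
  refine ⟨fun h => ?_, fun h Ξ => ?_⟩
  · have := h 0
    rw [matrixComplexNormal_eq] at this
    exact AEMeasurable.mono_ac this (volume_absolutelyContinuous_matrixGaussian one_pos _)
  · rw [matrixComplexNormal_eq]
    exact AEMeasurable.mono_ac h (matrixGaussian_absolutelyContinuous_volume 1 _)

lemma lintegral_matrixGaussian {s : ℝ} (Ξ : Fin m → Fin p → ℂ)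
    {f : (Fin m → Fin p → ℂ) → ℝ≥0∞} (hf : Measurable f) :
    ∫⁻ z, f z ∂matrixGaussian s Ξ = ∫⁻ z, ENNReal.ofReal (matrixGaussianPDF s Ξ z) * f z := by
  rw [matrixGaussian, lintegral_withDensity_eq_lintegral_mul _
    (continuous_matrixGaussianPDF s _).measurable.ennreal_ofReal hf]
  rfl

/-- The mean square deviation of a Gaussian matrix from a point is least at its mean. -/
lemma le_lintegral_sqNorm_sub {s : ℝ} (hs : 0 < s) (a Ξ : Fin m → Fin p → ℂ) :
    ENNReal.ofReal (m * p * s) ≤ ∫⁻ z, ENNReal.ofReal (sqNorm (a - z)) ∂matrixGaussian s Ξ := by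
  have hm : ∀ b : Fin m → Fin p → ℂ, Measurable fun z => ENNReal.ofReal (sqNorm (b - z)) :=
    fun b => (continuous_sqNorm.comp (by fun_prop)).measurable.ennreal_ofReal
  have hm' : Measurable fun z : Fin m → Fin p → ℂ => ENNReal.ofReal (sqNorm (z - Ξ)) :=
    (continuous_sqNorm.comp (by fun_prop)).measurable.ennreal_ofReal
  have hm2 : Measurable fun z => ENNReal.ofReal (sqNorm (a - (Ξ + Ξ - z))) :=
    (continuous_sqNorm.comp (by fun_prop)).measurable.ennreal_ofReal
  -- The reflection `z ↦ 2Ξ - z` preserves the law. Averaging over it cancels the cross term without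
  -- any integrability argument.
  have h1 : ∫⁻ z, ENNReal.ofReal (sqNorm (a - z)) ∂matrixGaussian s Ξ =
      ∫⁻ z, ENNReal.ofReal (sqNorm (a - (Ξ + Ξ - z))) ∂matrixGaussian s Ξ := by
    rw [lintegral_matrixGaussian _ (hm a), lintegral_matrixGaussian _ hm2,
      ← lintegral_sub_left_eq_self _ (Ξ + Ξ)]
    refine lintegral_congr fun z => ?_
    have : sqNorm (Ξ + Ξ - z - Ξ) = sqNorm (z - Ξ) := by
      unfold sqNorm
      refine Finset.sum_congr rfl fun i _ => Finset.sum_congr rfl fun j _ => ?_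
      rw [← norm_neg]
      simp only [Pi.sub_apply, Pi.add_apply]
      congr 2
      ring
    rw [matrixGaussianPDF_eq, matrixGaussianPDF_eq, this]
  -- Parallelogram law in each entry, with the nonnegative contribution of `a - Ξ` dropped.
  have h2 : ∀ z, ENNReal.ofReal (sqNorm (z - Ξ)) + ENNReal.ofReal (sqNorm (z - Ξ)) ≤
      ENNReal.ofReal (sqNorm (a - z)) + ENNReal.ofReal (sqNorm (a - (Ξ + Ξ - z))) := by
    intro z
    rw [← ENNReal.ofReal_add (sqNorm_nonneg _) (sqNorm_nonneg _),
      ← ENNReal.ofReal_add (sqNorm_nonneg _) (sqNorm_nonneg _)]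
    refine ENNReal.ofReal_le_ofReal ?_
    simp only [sqNorm, ← Finset.sum_add_distrib]
    refine Finset.sum_le_sum fun i _ => Finset.sum_le_sum fun j _ => ?_
    have := parallelogram_law_with_norm ℝ (a i j - Ξ i j) (z i j - Ξ i j)
    have e1 : a i j - Ξ i j + (z i j - Ξ i j) = a i j - (Ξ i j + Ξ i j - z i j) := by ring
    have e2 : a i j - Ξ i j - (z i j - Ξ i j) = a i j - z i j := by ring
    rw [e1, e2] at this
    simp only [Pi.sub_apply, Pi.add_apply]
    nlinarith [sq_nonneg ‖a i j - Ξ i j‖]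
  have h3 := lintegral_mono (μ := matrixGaussian s Ξ) h2
  rw [lintegral_add_left hm', lintegral_add_left (hm a), ← h1,
    lintegral_sqNorm_matrixGaussian hs] at h3
  by_contra! h
  exact absurd h3 (not_le.2 (ENNReal.add_lt_add h h))

/-- Completing the square: the marginal variance is `1 + τ`, and the posterior has mean `τ / (1 + τ)
* z` and variance `τ / (1 + τ)`. -/
lemma complexGaussianPDF_mul {τ : ℝ} (hτ : 0 < τ) (ξ z : ℂ) :
    complexGaussianPDF 1 ξ z * complexGaussianPDF τ 0 ξ =
      complexGaussianPDF (1 + τ) 0 z *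
        complexGaussianPDF (τ / (1 + τ)) ((τ / (1 + τ) : ℝ) * z) ξ := by
  have hπ := Real.pi_pos
  simp only [complexGaussianPDF]
  rw [mul_mul_mul_comm, mul_mul_mul_comm (_ : ℝ) (Real.exp _), ← Real.exp_add, ← Real.exp_add]
  congr 1
  · field_simp
  · congr 1
    simp only [← Complex.normSq_eq_norm_sq, Complex.normSq_apply, Complex.sub_re, Complex.sub_im,
      Complex.mul_re, Complex.mul_im, Complex.ofReal_re, Complex.ofReal_im, Complex.zero_re,
      Complex.zero_im]
    field_simp
    ring

/-- A Gaussian prior turns the joint density into marginal times posterior density. -/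
lemma matrixGaussianPDF_mul {τ : ℝ} (hτ : 0 < τ) (Ξ z : Fin m → Fin p → ℂ) :
    matrixGaussianPDF 1 Ξ z * matrixGaussianPDF τ 0 Ξ =
      matrixGaussianPDF (1 + τ) 0 z *
        matrixGaussianPDF (τ / (1 + τ)) (fun i j => ((τ / (1 + τ) : ℝ) * z i j)) Ξ := by
  simp only [matrixGaussianPDF, ← Finset.prod_mul_distrib, Pi.zero_apply,
    complexGaussianPDF_mul hτ]

lemma measurable_matrixGaussianPDF_uncurry (s : ℝ) :
    Measurable fun q : (Fin m → Fin p → ℂ) × (Fin m → Fin p → ℂ) =>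
      ENNReal.ofReal (matrixGaussianPDF s q.1 q.2) := by
  simp only [matrixGaussianPDF_eq]
  exact (Continuous.mul continuous_const (Real.continuous_exp.comp
    ((continuous_sqNorm.comp (by fun_prop)).neg.div_const _))).measurable.ennreal_ofReal

/-- The Bayes risk for a Gaussian prior bounds the maximal risk from below. -/
lemma bayes_le_iSup_risk {δ : (Fin m → Fin p → ℂ) → Fin m → Fin p → ℂ} (hδ : Measurable δ)
    {τ : ℝ} (hτ : 0 < τ) :
    ENNReal.ofReal (m * p * (τ / (1 + τ))) ≤
      ⨆ Ξ, ∫⁻ z, ENNReal.ofReal (sqNorm (δ z - Ξ)) ∂matrixGaussian 1 Ξ := by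
  have hs : 0 < τ / (1 + τ) := by positivity
  have hprob := isProbabilityMeasure_matrixGaussian hτ (0 : Fin m → Fin p → ℂ)
  have hprob' := isProbabilityMeasure_matrixGaussian (s := 1 + τ) (by positivity)
    (0 : Fin m → Fin p → ℂ)
  have hL : Measurable fun q : (Fin m → Fin p → ℂ) × (Fin m → Fin p → ℂ) =>
      ENNReal.ofReal (sqNorm (δ q.2 - q.1)) :=
    (continuous_sqNorm.measurable.comp
      ((hδ.comp measurable_snd).sub measurable_fst)).ennreal_ofReal
  have hJ : Measurable fun q : (Fin m → Fin p → ℂ) × (Fin m → Fin p → ℂ) =>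
      ENNReal.ofReal (matrixGaussianPDF 1 q.1 q.2) * ENNReal.ofReal (sqNorm (δ q.2 - q.1)) :=
    (measurable_matrixGaussianPDF_uncurry 1).mul hL
  calc ENNReal.ofReal (m * p * (τ / (1 + τ)))
      = ∫⁻ _z, ENNReal.ofReal (m * p * (τ / (1 + τ)))
          ∂matrixGaussian (1 + τ) (0 : Fin m → Fin p → ℂ) := by simp
    _ ≤ ∫⁻ z, (∫⁻ Ξ, ENNReal.ofReal (sqNorm (δ z - Ξ))
          ∂matrixGaussian (τ / (1 + τ)) (fun i j => ((τ / (1 + τ) : ℝ) * z i j)))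
          ∂matrixGaussian (1 + τ) (0 : Fin m → Fin p → ℂ) :=
        lintegral_mono fun z => le_lintegral_sqNorm_sub hs _ _
    _ = ∫⁻ z, ENNReal.ofReal (matrixGaussianPDF (1 + τ) 0 z) *
          ∫⁻ Ξ, ENNReal.ofReal (sqNorm (δ z - Ξ))
          ∂matrixGaussian (τ / (1 + τ)) (fun i j => ((τ / (1 + τ) : ℝ) * z i j)) := by
        -- A finite measurable density makes measurability of the inner integral in `z` unnecessary.
        rw [matrixGaussian, lintegral_withDensity_eq_lintegral_mul_non_measurable _
          (continuous_matrixGaussianPDF _ _).measurable.ennreal_ofReal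
          (.of_forall fun _ => ENNReal.ofReal_lt_top)]
        rfl
    _ = ∫⁻ z, ∫⁻ Ξ, ENNReal.ofReal (matrixGaussianPDF τ 0 Ξ) *
          (ENNReal.ofReal (matrixGaussianPDF 1 Ξ z) * ENNReal.ofReal (sqNorm (δ z - Ξ))) := by
        refine lintegral_congr fun z => ?_
        have hm : Measurable fun Ξ => ENNReal.ofReal (sqNorm (δ z - Ξ)) :=
          (continuous_sqNorm.comp (continuous_const.sub continuous_id)).measurable.ennreal_ofReal
        rw [lintegral_matrixGaussian _ hm, ← lintegral_const_mul' _ _ ENNReal.ofReal_ne_top]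
        refine lintegral_congr fun Ξ => ?_
        rw [← mul_assoc, ← mul_assoc,
          ← ENNReal.ofReal_mul (matrixGaussianPDF_nonneg (by positivity) _ _),
          ← ENNReal.ofReal_mul (matrixGaussianPDF_nonneg hτ _ _),
          ← matrixGaussianPDF_mul hτ, mul_comm (matrixGaussianPDF 1 Ξ z)]
    _ = ∫⁻ Ξ, ∫⁻ z, ENNReal.ofReal (matrixGaussianPDF τ 0 Ξ) *
          (ENNReal.ofReal (matrixGaussianPDF 1 Ξ z) * ENNReal.ofReal (sqNorm (δ z - Ξ))) := by
        refine (lintegral_lintegral_swap ?_).symm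
        exact (((continuous_matrixGaussianPDF τ 0).measurable.ennreal_ofReal.comp
          measurable_fst).mul hJ).aemeasurable
    _ = ∫⁻ Ξ, (∫⁻ z, ENNReal.ofReal (sqNorm (δ z - Ξ)) ∂matrixGaussian 1 Ξ)
          ∂matrixGaussian τ (0 : Fin m → Fin p → ℂ) := by
        have hm : ∀ Ξ, Measurable fun z => ENNReal.ofReal (sqNorm (δ z - Ξ)) := fun Ξ =>
          (continuous_sqNorm.measurable.comp (hδ.sub_const Ξ)).ennreal_ofReal
        have h1 : ∀ Ξ, ∫⁻ z, ENNReal.ofReal (sqNorm (δ z - Ξ)) ∂matrixGaussian 1 Ξ =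
          ∫⁻ z, ENNReal.ofReal (matrixGaussianPDF 1 Ξ z) * ENNReal.ofReal (sqNorm (δ z - Ξ)) :=
          fun Ξ => lintegral_matrixGaussian _ (hm Ξ)
        simp_rw [h1]
        rw [lintegral_matrixGaussian _ hJ.lintegral_prod_right']
        refine lintegral_congr fun Ξ => ?_
        rw [lintegral_const_mul' _ _ ENNReal.ofReal_ne_top]
    _ ≤ ∫⁻ _Ξ, (⨆ Ξ, ∫⁻ z, ENNReal.ofReal (sqNorm (δ z - Ξ)) ∂matrixGaussian 1 Ξ)
          ∂matrixGaussian τ (0 : Fin m → Fin p → ℂ) :=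
        lintegral_mono fun Ξ => le_iSup
          (fun Ξ => ∫⁻ z, ENNReal.ofReal (sqNorm (δ z - Ξ)) ∂matrixGaussian 1 Ξ) Ξ
    _ = _ := by simp

/-- Pass to a measurable version of `δ`, which has the same risk, and let the prior variance `τ = n
+ 1` tend to infinity. -/
lemma mul_le_iSup_lintegral {δ : (Fin m → Fin p → ℂ) → Fin m → Fin p → ℂ}
    (hδ : AEMeasurable δ volume) : ENNReal.ofReal (m * p) ≤
      ⨆ Ξ, ∫⁻ z, ENNReal.ofReal (sqNorm (δ z - Ξ)) ∂matrixGaussian 1 Ξ := by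
  have h1 : ∀ Ξ, ∫⁻ z, ENNReal.ofReal (sqNorm (δ z - Ξ)) ∂matrixGaussian 1 Ξ =
      ∫⁻ z, ENNReal.ofReal (sqNorm (hδ.mk _ z - Ξ)) ∂matrixGaussian 1 Ξ := fun Ξ => by
    refine lintegral_congr_ae ?_
    filter_upwards [(matrixGaussian_absolutelyContinuous_volume 1 Ξ) hδ.ae_eq_mk] with z hz
    rw [← hz]
  simp_rw [h1]
  refine le_of_tendsto' (f := fun n : ℕ => ENNReal.ofReal (m * p * ((n + 1 : ℝ) / (1 + (n + 1)))))
    (x := Filter.atTop) ?_ fun n => bayes_le_iSup_risk hδ.measurable_mk (by positivity)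
  refine ENNReal.tendsto_ofReal ?_
  have h3 := (tendsto_natCast_div_add_atTop (1 : ℝ)).comp (Filter.tendsto_add_atTop_nat 1)
  have h4 := h3.const_mul ((m : ℝ) * p)
  rw [mul_one] at h4
  refine h4.congr fun n => ?_
  simp [add_comm]

lemma mul_le_iSup_risk {δ : Matrix (Fin m) (Fin p) ℂ → Matrix (Fin m) (Fin p) ℂ}
    (hδ : IsEstimator δ) : ENNReal.ofReal (m * p) ≤ ⨆ Ξ, risk δ Ξ := by
  refine (mul_le_iSup_lintegral ((isEstimator_iff δ).1 hδ)).trans (le_of_eq ?_)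
  exact iSup_congr fun Ξ => (risk_eq δ Ξ).symm

end BayesLowerBound

/-! ### Finite perturbation bounds for eigenvalues, spectral projections and functions of the
spectrum. -/

section SpectralPerturbation

variable {m p : ℕ}

lemma sqNorm_eq_trace (A : Matrix (Fin m) (Fin p) ℂ) : sqNorm A = (Matrix.trace (Aᴴ * A)).re := by
  have := quadLoss_eq A 0
  simp only [quadLoss, sub_zero] at this
  exact this.symm

/-- The orthogonal projection onto the `k`-th column of a unitary matrix. -/
def specProj (U : Matrix (Fin p) (Fin p) ℂ) (k : Fin p) : Matrix (Fin p) (Fin p) ℂ :=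
  U * Matrix.single k k 1 * Uᴴ

/-- The squared moduli of the inner products between the columns of two matrices. -/
def overlap (U U' : Matrix (Fin p) (Fin p) ℂ) (j k : Fin p) : ℝ := ‖(Uᴴ * U') j k‖ ^ 2

lemma overlap_nonneg (U U' : Matrix (Fin p) (Fin p) ℂ) (j k : Fin p) : 0 ≤ overlap U U' j k := by
  unfold overlap; positivity

lemma sum_specProj_smul (U : Matrix (Fin p) (Fin p) ℂ) (h : Fin p → ℂ) :
    U * Matrix.diagonal h * Uᴴ = ∑ k, h k • specProj U k := by
  have : Matrix.diagonal h = ∑ k, h k • Matrix.single k k (1 : ℂ) := by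
    ext i j
    simp only [Matrix.diagonal_apply, Matrix.sum_apply, Matrix.smul_apply, Matrix.single_apply]
    by_cases hij : i = j
    · subst hij; simp
    · simp only [hij, if_false, smul_eq_mul]
      refine (Finset.sum_eq_zero fun k _ => ?_).symm
      rw [if_neg, mul_zero]
      rintro ⟨rfl, rfl⟩
      exact hij rfl
  rw [this, Finset.mul_sum, Finset.sum_mul]
  simp only [specProj, Matrix.mul_smul, Matrix.smul_mul]

lemma conjTranspose_specProj (U : Matrix (Fin p) (Fin p) ℂ) (k : Fin p) :
    (specProj U k)ᴴ = specProj U k := by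
  simp [specProj, Matrix.mul_assoc]

lemma conjTranspose_mul_self_of_unitary {U : Matrix (Fin p) (Fin p) ℂ}
    (hU : U ∈ Matrix.unitaryGroup (Fin p) ℂ) : Uᴴ * U = 1 :=
  Matrix.mem_unitaryGroup_iff'.1 hU

lemma mul_conjTranspose_self_of_unitary {U : Matrix (Fin p) (Fin p) ℂ}
    (hU : U ∈ Matrix.unitaryGroup (Fin p) ℂ) : U * Uᴴ = 1 :=
  Matrix.mem_unitaryGroup_iff.1 hU

lemma specProj_mul_specProj {U : Matrix (Fin p) (Fin p) ℂ}
    (hU : U ∈ Matrix.unitaryGroup (Fin p) ℂ) (j k : Fin p) :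
    specProj U j * specProj U k = if j = k then specProj U k else 0 := by
  have h1 := conjTranspose_mul_self_of_unitary hU
  have : specProj U j * specProj U k =
      U * (Matrix.single j j 1 * (Uᴴ * U) * Matrix.single k k 1) * Uᴴ := by
    simp only [specProj, Matrix.mul_assoc]
  rw [this, h1, Matrix.mul_one]
  split_ifs with h
  · subst h; simp [specProj]
  · simp [Matrix.single_mul_single_of_ne, h]

lemma sum_specProj {U : Matrix (Fin p) (Fin p) ℂ}
    (hU : U ∈ Matrix.unitaryGroup (Fin p) ℂ) : ∑ k, specProj U k = 1 := by
  have h := sum_specProj_smul U 1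
  simp only [Pi.one_apply, one_smul] at h
  rw [← h]
  have : Matrix.diagonal (1 : Fin p → ℂ) = 1 := Matrix.diagonal_one
  rw [this, Matrix.mul_one, mul_conjTranspose_self_of_unitary hU]

lemma trace_specProj {U : Matrix (Fin p) (Fin p) ℂ}
    (hU : U ∈ Matrix.unitaryGroup (Fin p) ℂ) (k : Fin p) : (specProj U k).trace = 1 := by
  rw [specProj, Matrix.trace_mul_comm, ← Matrix.mul_assoc, conjTranspose_mul_self_of_unitary hU]
  simp

lemma trace_specProj_mul (U U' : Matrix (Fin p) (Fin p) ℂ) (j k : Fin p) :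
    (specProj U j * specProj U' k).trace = overlap U U' j k := by
  have h1 : (specProj U j * specProj U' k).trace =
      (Matrix.single j j 1 * (Uᴴ * U') * (Matrix.single k k 1 * (Uᴴ * U')ᴴ)).trace := by
    rw [specProj, specProj, Matrix.conjTranspose_mul, Matrix.conjTranspose_conjTranspose]
    simp only [Matrix.mul_assoc]
    rw [Matrix.trace_mul_comm]
    simp only [Matrix.mul_assoc]
  rw [h1, overlap, ← Complex.normSq_eq_norm_sq, Complex.normSq_eq_conj_mul_self]
  generalize Uᴴ * U' = M
  rw [← Matrix.mul_assoc, Matrix.mul_assoc _ M, Matrix.trace]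
  simp only [Matrix.diag_apply, Matrix.mul_apply, Matrix.single_apply]
  simp only [Matrix.conjTranspose_apply, ite_and]
  simp [Finset.sum_ite_eq, mul_comm]

/-- Each family of projections resolves the identity, so together with `sum_overlap_right` the
overlap matrix is doubly stochastic. This drives the eigenvalue bounds below. -/
lemma sum_overlap_left {U U' : Matrix (Fin p) (Fin p) ℂ}
    (hU : U ∈ Matrix.unitaryGroup (Fin p) ℂ) (hU' : U' ∈ Matrix.unitaryGroup (Fin p) ℂ)
    (k : Fin p) : ∑ j, overlap U U' j k = 1 := by
  have : ((∑ j, overlap U U' j k : ℝ) : ℂ) = 1 := by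
    push_cast
    simp_rw [← trace_specProj_mul]
    rw [← Matrix.trace_sum, ← Finset.sum_mul, sum_specProj hU, one_mul, trace_specProj hU']
  exact_mod_cast this

lemma sum_overlap_right {U U' : Matrix (Fin p) (Fin p) ℂ}
    (hU : U ∈ Matrix.unitaryGroup (Fin p) ℂ) (hU' : U' ∈ Matrix.unitaryGroup (Fin p) ℂ)
    (j : Fin p) : ∑ k, overlap U U' j k = 1 := by
  have : ((∑ k, overlap U U' j k : ℝ) : ℂ) = 1 := by
    push_cast
    simp_rw [← trace_specProj_mul]
    rw [← Matrix.trace_sum, ← Finset.mul_sum, sum_specProj hU', mul_one, trace_specProj hU]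
  exact_mod_cast this

lemma sqNorm_conjTranspose_mul_mul {U U' : Matrix (Fin p) (Fin p) ℂ}
    (hU : U ∈ Matrix.unitaryGroup (Fin p) ℂ) (hU' : U' ∈ Matrix.unitaryGroup (Fin p) ℂ)
    (A : Matrix (Fin p) (Fin p) ℂ) : sqNorm (Uᴴ * A * U') = sqNorm A := by
  rw [sqNorm_eq_trace, sqNorm_eq_trace]
  congr 1
  simp only [Matrix.conjTranspose_mul, Matrix.conjTranspose_conjTranspose]
  have : U'ᴴ * (Aᴴ * U) * (Uᴴ * A * U') = U'ᴴ * (Aᴴ * (U * Uᴴ) * A * U') := by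
    simp only [Matrix.mul_assoc]
  rw [this, mul_conjTranspose_self_of_unitary hU, Matrix.mul_one, Matrix.trace_mul_comm,
    Matrix.mul_assoc, mul_conjTranspose_self_of_unitary hU', Matrix.mul_one]

namespace IsOrderedSpectralDecomposition

variable {W W' U U' : Matrix (Fin p) (Fin p) ℂ} {ℓ ℓ' : Fin p → ℝ}

lemma eq_sum (h : IsOrderedSpectralDecomposition W U ℓ) :
    W = ∑ k, (ℓ k : ℂ) • specProj U k := h.eq.trans (sum_specProj_smul _ _)

lemma specProj_mul_self (h : IsOrderedSpectralDecomposition W U ℓ) (k : Fin p) :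
    specProj U k * W = (ℓ k : ℂ) • specProj U k := by
  rw [h.eq_sum, Finset.mul_sum]
  simp [specProj_mul_specProj h.unitary]

lemma self_mul_specProj (h : IsOrderedSpectralDecomposition W U ℓ) (k : Fin p) :
    W * specProj U k = (ℓ k : ℂ) • specProj U k := by
  rw [h.eq_sum, Finset.sum_mul]
  simp [specProj_mul_specProj h.unitary]

/-- The identity behind the Hoffman–Wielandt inequality: the `(j, k)` entry of `Uᴴ * (W - W') * U'`
is `(ℓ j - ℓ' k)` times that of `Uᴴ * U'`, and the Frobenius norm is unitarily invariant. -/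
lemma sum_mul_overlap (h : IsOrderedSpectralDecomposition W U ℓ)
    (h' : IsOrderedSpectralDecomposition W' U' ℓ') :
    ∑ j, ∑ k, (ℓ j - ℓ' k) ^ 2 * overlap U U' j k = sqNorm (W - W') := by
  rw [← sqNorm_conjTranspose_mul_mul h.unitary h'.unitary]
  unfold sqNorm
  refine Finset.sum_congr rfl fun j _ => Finset.sum_congr rfl fun k _ => ?_
  have h1 : Uᴴ * (W - W') * U' = Matrix.diagonal (fun k => (ℓ k : ℂ)) * (Uᴴ * U') -
      (Uᴴ * U') * Matrix.diagonal (fun k => (ℓ' k : ℂ)) := by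
    have e1 : Uᴴ * W = Matrix.diagonal (fun k => (ℓ k : ℂ)) * Uᴴ := by
      rw [h.eq, ← Matrix.mul_assoc, ← Matrix.mul_assoc, conjTranspose_mul_self_of_unitary h.unitary,
        Matrix.one_mul]
    have e2 : W' * U' = U' * Matrix.diagonal (fun k => (ℓ' k : ℂ)) := by
      rw [h'.eq, Matrix.mul_assoc, conjTranspose_mul_self_of_unitary h'.unitary, Matrix.mul_one]
    rw [Matrix.mul_sub, Matrix.sub_mul, e1, Matrix.mul_assoc _ W', e2]
    simp only [Matrix.mul_assoc]
  rw [h1, Matrix.sub_apply, Matrix.diagonal_mul, Matrix.mul_diagonal, mul_comm _ (ℓ' k : ℂ),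
    ← sub_mul, norm_mul, mul_pow, overlap, ← Complex.ofReal_sub, Complex.norm_real,
    Real.norm_eq_abs, sq_abs]

lemma sub_sq_mul_overlap_le (h : IsOrderedSpectralDecomposition W U ℓ)
    (h' : IsOrderedSpectralDecomposition W' U' ℓ') (j k : Fin p) :
    (ℓ j - ℓ' k) ^ 2 * overlap U U' j k ≤ sqNorm (W - W') := by
  rw [← h.sum_mul_overlap h']
  have h0 : ∀ j k, 0 ≤ (ℓ j - ℓ' k) ^ 2 * overlap U U' j k := fun j k =>
    mul_nonneg (sq_nonneg _) (overlap_nonneg _ _ _ _)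
  exact (Finset.single_le_sum (fun k _ => h0 j k) (Finset.mem_univ k)).trans
    (Finset.single_le_sum (f := fun j => ∑ k, (ℓ j - ℓ' k) ^ 2 * overlap U U' j k)
      (fun j _ => Finset.sum_nonneg fun k _ => h0 j k) (Finset.mem_univ j))

/-- A counting argument on the doubly stochastic overlaps. The columns `j ≤ k` carry mass `k + 1`,
of which the rows `i < k` can hold at most `k`, so the block `i ≥ k`, `j ≤ k` carries mass at least
one. On that block `ℓ i ≤ ℓ k < ℓ' k ≤ ℓ' j`, so each squared difference is at least `(ℓ k - ℓ' k) ^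
2`. -/
lemma sub_sq_le_of_lt (h : IsOrderedSpectralDecomposition W U ℓ)
    (h' : IsOrderedSpectralDecomposition W' U' ℓ') {k : Fin p} (hk : ℓ k < ℓ' k) :
    (ℓ k - ℓ' k) ^ 2 ≤ sqNorm (W - W') := by
  set o := overlap U U'
  have ho : ∀ i j, 0 ≤ o i j := overlap_nonneg U U'
  have h1 : ∑ j ∈ Finset.Iic k, ∑ i, o i j = k + 1 := by
    rw [Finset.sum_congr rfl fun j _ => sum_overlap_left h.unitary h'.unitary j]
    simp
  have h2 : ∑ j ∈ Finset.Iic k, ∑ i ∈ Finset.Iio k, o i j ≤ k := by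
    rw [Finset.sum_comm]
    calc ∑ i ∈ Finset.Iio k, ∑ j ∈ Finset.Iic k, o i j ≤ ∑ i ∈ Finset.Iio k, (1 : ℝ) := by
          refine Finset.sum_le_sum fun i _ => ?_
          rw [← sum_overlap_right h.unitary h'.unitary i]
          exact Finset.sum_le_sum_of_subset_of_nonneg (Finset.subset_univ _) fun _ _ _ => ho _ _
      _ = k := by simp
  have h3 : ∀ j, ∑ i, o i j = ∑ i ∈ Finset.Iio k, o i j + ∑ i ∈ Finset.Ici k, o i j := fun j => by
    rw [← Finset.sum_union]
    · congr 1
      ext i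
      simpa using lt_or_ge i k
    · rw [Finset.disjoint_left]
      intro i hi hi'
      exact absurd (Finset.mem_Iio.1 hi) (not_lt.2 (Finset.mem_Ici.1 hi'))
  simp_rw [h3] at h1
  rw [Finset.sum_add_distrib] at h1
  have h4 : 1 ≤ ∑ j ∈ Finset.Iic k, ∑ i ∈ Finset.Ici k, o i j := by linarith
  calc (ℓ k - ℓ' k) ^ 2 ≤ (ℓ k - ℓ' k) ^ 2 * ∑ j ∈ Finset.Iic k, ∑ i ∈ Finset.Ici k, o i j :=
        le_mul_of_one_le_right (sq_nonneg _) h4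
    _ ≤ ∑ j ∈ Finset.Iic k, ∑ i ∈ Finset.Ici k, (ℓ i - ℓ' j) ^ 2 * o i j := by
        simp_rw [Finset.mul_sum]
        refine Finset.sum_le_sum fun j hj => Finset.sum_le_sum fun i hi => ?_
        refine mul_le_mul_of_nonneg_right ?_ (ho i j)
        have a1 := h.antitone (Finset.mem_Ici.1 hi)
        have a2 := h'.antitone (Finset.mem_Iic.1 hj)
        nlinarith
    _ ≤ ∑ j, ∑ i, (ℓ i - ℓ' j) ^ 2 * o i j := by
        have h0 : ∀ i j, 0 ≤ (ℓ i - ℓ' j) ^ 2 * o i j := fun i j =>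
          mul_nonneg (sq_nonneg _) (ho i j)
        refine (Finset.sum_le_sum fun j _ => ?_).trans (Finset.sum_le_sum_of_subset_of_nonneg
          (Finset.subset_univ _) fun j _ _ => Finset.sum_nonneg fun i _ => h0 i j)
        exact Finset.sum_le_sum_of_subset_of_nonneg (Finset.subset_univ _) fun _ _ _ => h0 _ _
    _ = sqNorm (W - W') := by rw [Finset.sum_comm]; exact h.sum_mul_overlap h'

/-- Ordered eigenvalues are Lipschitz with respect to the Frobenius norm. -/
lemma sub_sq_le (h : IsOrderedSpectralDecomposition W U ℓ)
    (h' : IsOrderedSpectralDecomposition W' U' ℓ') (k : Fin p) :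
    (ℓ k - ℓ' k) ^ 2 ≤ sqNorm (W - W') := by
  rcases lt_trichotomy (ℓ k) (ℓ' k) with hk | hk | hk
  · exact h.sub_sq_le_of_lt h' hk
  · rw [hk, sub_self, zero_pow two_ne_zero]; exact sqNorm_nonneg _
  · have := h'.sub_sq_le_of_lt h hk
    have e : sqNorm (W' - W) = sqNorm (W - W') := by simp [sqNorm, norm_sub_rev]
    rw [e] at this
    linarith [sub_sq_comm (ℓ k) (ℓ' k)]

/-- Both projections have rank one, so the squared distance is `2 - 2 * overlap U U' k k`; the
column sum of the overlaps does the rest. -/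
lemma sqNorm_specProj_sub (h : IsOrderedSpectralDecomposition W U ℓ)
    (h' : IsOrderedSpectralDecomposition W' U' ℓ') (k : Fin p) :
    sqNorm (specProj U k - specProj U' k) =
      2 * ∑ j ∈ Finset.univ.erase k, overlap U U' j k := by
  rw [sqNorm_eq_trace]
  simp only [Matrix.conjTranspose_sub, conjTranspose_specProj, Matrix.sub_mul, Matrix.mul_sub,
    specProj_mul_specProj h.unitary, specProj_mul_specProj h'.unitary, if_true, Matrix.trace_sub,
    trace_specProj h.unitary, trace_specProj h'.unitary, trace_specProj_mul]
  rw [← trace_specProj_mul U' U, Matrix.trace_mul_comm, trace_specProj_mul]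
  have := sum_overlap_left h.unitary h'.unitary k
  rw [← Finset.add_sum_erase _ _ (Finset.mem_univ k)] at this
  simp only [Complex.sub_re, Complex.one_re, Complex.ofReal_re]
  linarith

lemma sqNorm_specProj_sub_le (h : IsOrderedSpectralDecomposition W U ℓ)
    (h' : IsOrderedSpectralDecomposition W' U' ℓ') (k : Fin p) (hk : ∀ j, j ≠ k → ℓ j ≠ ℓ' k) :
    sqNorm (specProj U k - specProj U' k) ≤
      2 * ∑ j ∈ Finset.univ.erase k, sqNorm (W - W') / (ℓ j - ℓ' k) ^ 2 := by
  rw [h.sqNorm_specProj_sub h']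
  refine mul_le_mul_of_nonneg_left (Finset.sum_le_sum fun j hj => ?_) two_pos.le
  have : 0 < (ℓ j - ℓ' k) ^ 2 :=
    sq_pos_of_ne_zero (sub_ne_zero.2 (hk j (Finset.ne_of_mem_erase hj)))
  rw [le_div_iff₀ this, mul_comm]
  exact h.sub_sq_mul_overlap_le h' j k

end IsOrderedSpectralDecomposition

/-- The mixed divided differences of `k ↦ -c k / ℓ k`. -/
def mixedDivDiff (c ℓ ℓ' : Fin p → ℝ) (j k : Fin p) : ℝ :=
  if j = k then c k / (ℓ k * ℓ' k) else (c j / ℓ j - c k / ℓ' k) / (ℓ' k - ℓ j)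

/-- The matrix `-U Diag(c_1 / ℓ_1, …, c_p / ℓ_p) U^*`. -/
def specFun (c : Fin p → ℝ) (U : Matrix (Fin p) (Fin p) ℂ) (ℓ : Fin p → ℝ) :
    Matrix (Fin p) (Fin p) ℂ := ∑ k, ((-c k / ℓ k : ℝ) : ℂ) • specProj U k

/-- An exact difference formula, obtained by sandwiching between `specProj U j` and `specProj U' k`.
There `W' - W` acts as `ℓ' k - ℓ j` and the difference of functions as `c j / ℓ j - c k / ℓ' k`. On
the diagonal the divided difference simplifies to `c k / (ℓ k * ℓ' k)`, so `ℓ k = ℓ' k` is allowed.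
Dividing by the step and passing to the limit gives the derivative, with no derivative of the
eigenvectors involved. -/
lemma specFun_sub_specFun {W W' U U' : Matrix (Fin p) (Fin p) ℂ} {ℓ ℓ' : Fin p → ℝ}
    (h : IsOrderedSpectralDecomposition W U ℓ) (h' : IsOrderedSpectralDecomposition W' U' ℓ')
    (hne : ∀ j k, j ≠ k → ℓ j ≠ ℓ' k) (h0 : ∀ k, ℓ k ≠ 0) (h0' : ∀ k, ℓ' k ≠ 0)
    (c : Fin p → ℝ) :
    specFun c U' ℓ' - specFun c U ℓ =
      ∑ j, ∑ k, (mixedDivDiff c ℓ ℓ' j k : ℂ) • (specProj U j * (W' - W) * specProj U' k) := by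
  have h1 : ∀ A : Matrix (Fin p) (Fin p) ℂ, A = ∑ j, ∑ k, specProj U j * A * specProj U' k := by
    intro A
    simp_rw [← Finset.mul_sum, sum_specProj h'.unitary, mul_one, ← Finset.sum_mul,
      sum_specProj h.unitary, one_mul]
  rw [h1 (_ - _)]
  refine Finset.sum_congr rfl fun j _ => Finset.sum_congr rfl fun k _ => ?_
  have e1 : specProj U j * specFun c U ℓ = ((-c j / ℓ j : ℝ) : ℂ) • specProj U j := by
    simp [specFun, Finset.mul_sum, specProj_mul_specProj h.unitary]
  have e2 : specFun c U' ℓ' * specProj U' k = ((-c k / ℓ' k : ℝ) : ℂ) • specProj U' k := by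
    simp [specFun, Finset.sum_mul, specProj_mul_specProj h'.unitary]
  rw [mul_sub, sub_mul, e1, mul_assoc, e2, mul_sub, sub_mul, h.specProj_mul_self, mul_assoc,
    h'.self_mul_specProj]
  simp only [Matrix.mul_smul, Matrix.smul_mul, ← sub_smul, smul_smul]
  congr 1
  norm_cast
  rw [mixedDivDiff]
  split_ifs with hjk
  · subst hjk
    have := h0 j
    have := h0' j
    field_simp
    ring
  · have : ℓ' k - ℓ j ≠ 0 := sub_ne_zero.2 (hne j k hjk).symm
    field_simp
    ring

end SpectralPerturbation

/-! ### Continuity and directional derivatives of eigenvalues and spectral functions of `zᴴ * z`. -/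

section SpectralCalculus

open Filter Topology

variable {m p : ℕ}

lemma Filter.Tendsto.matrix_apply {α : Type*} {f : Filter α} {a b : ℕ}
    {A : α → Matrix (Fin a) (Fin b) ℂ} {A₀ : Matrix (Fin a) (Fin b) ℂ}
    (hA : Tendsto A f (𝓝 A₀)) (i : Fin a) (j : Fin b) :
    Tendsto (fun x => A x i j) f (𝓝 (A₀ i j)) :=
  ((continuous_id.matrix_elem i j).tendsto A₀).comp hA

lemma Filter.Tendsto.matrix_mul_matrix {α : Type*} {f : Filter α} {a b d : ℕ}
    {A : α → Matrix (Fin a) (Fin b) ℂ} {B : α → Matrix (Fin b) (Fin d) ℂ}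
    {A₀ : Matrix (Fin a) (Fin b) ℂ} {B₀ : Matrix (Fin b) (Fin d) ℂ}
    (hA : Tendsto A f (𝓝 A₀)) (hB : Tendsto B f (𝓝 B₀)) :
    Tendsto (fun x => A x * B x) f (𝓝 (A₀ * B₀)) := by
  refine tendsto_pi_nhds.2 fun i => tendsto_pi_nhds.2 fun j => ?_
  simp only [Matrix.mul_apply]
  exact tendsto_finsetSum _ fun k _ => (hA.matrix_apply i k).mul (hB.matrix_apply k j)

lemma Filter.Tendsto.matrix_trace' {α : Type*} {f : Filter α} {a : ℕ}
    {A : α → Matrix (Fin a) (Fin a) ℂ} {A₀ : Matrix (Fin a) (Fin a) ℂ}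
    (hA : Tendsto A f (𝓝 A₀)) : Tendsto (fun x => (A x).trace) f (𝓝 A₀.trace) :=
  tendsto_finsetSum _ fun i _ => hA.matrix_apply i i

lemma tendsto_of_tendsto_sqNorm_sub {α : Type*} {f : Filter α}
    {A : α → Matrix (Fin m) (Fin p) ℂ} {B : Matrix (Fin m) (Fin p) ℂ}
    (h : Tendsto (fun x => sqNorm (B - A x)) f (𝓝 0)) : Tendsto A f (𝓝 B) := by
  refine tendsto_pi_nhds.2 fun i => tendsto_pi_nhds.2 fun j => ?_
  rw [tendsto_iff_norm_sub_tendsto_zero]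
  have h2 : Tendsto (fun x => √(sqNorm (B - A x))) f (𝓝 0) := by
    simpa using h.sqrt
  refine squeeze_zero (fun _ => norm_nonneg _) (fun x => Real.le_sqrt_of_sq_le ?_) h2
  rw [norm_sub_rev]
  unfold sqNorm
  exact (Finset.single_le_sum (f := fun j => ‖(B - A x) i j‖ ^ 2) (fun _ _ => by positivity)
    (Finset.mem_univ j)).trans (Finset.single_le_sum (f := fun i => ∑ j, ‖(B - A x) i j‖ ^ 2)
    (fun _ _ => by positivity) (Finset.mem_univ i))

/-- Eigenvalues in strictly decreasing order, all of them positive. -/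
def IsSimplePos (l : Fin p → ℝ) : Prop := StrictAnti l ∧ ∀ k, 0 < l k

lemma IsSimplePos.ne {l : Fin p → ℝ} (h : IsSimplePos l) {j k : Fin p} (hjk : j ≠ k) :
    l j ≠ l k := fun e => hjk (h.1.injective e)

/-- The derivative of `zᴴ * z` in the direction `v`. -/
def gramDeriv (z v : Matrix (Fin m) (Fin p) ℂ) : Matrix (Fin p) (Fin p) ℂ := vᴴ * z + zᴴ * v

lemma gram_add_smul_sub (z v : Matrix (Fin m) (Fin p) ℂ) (t : ℝ) :
    (z + t • v)ᴴ * (z + t • v) - zᴴ * z = t • (gramDeriv z v + t • (vᴴ * v)) := by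
  simp only [gramDeriv, Matrix.conjTranspose_add, Matrix.conjTranspose_smul, Matrix.add_mul,
    Matrix.mul_add, Matrix.smul_mul, Matrix.mul_smul, smul_add, star_trivial]
  abel

variable {U : Matrix (Fin m) (Fin p) ℂ → Matrix (Fin p) (Fin p) ℂ}
  {ℓ : Matrix (Fin m) (Fin p) ℂ → Fin p → ℝ}

lemma continuous_gram : Continuous fun z : Matrix (Fin m) (Fin p) ℂ => zᴴ * z :=
  continuous_id.matrix_conjTranspose.matrix_mul continuous_id

lemma tendsto_sqNorm_gram_sub (z : Matrix (Fin m) (Fin p) ℂ) :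
    Tendsto (fun z' : Matrix (Fin m) (Fin p) ℂ => sqNorm (zᴴ * z - z'ᴴ * z')) (𝓝 z) (𝓝 0) := by
  have h : Continuous fun z' : Matrix (Fin m) (Fin p) ℂ => sqNorm (zᴴ * z - z'ᴴ * z') :=
    continuous_sqNorm.comp (continuous_const.sub continuous_gram)
  have := h.tendsto z
  simpa [sqNorm] using this

lemma continuous_eigenvalue
    (hUℓ : ∀ z : Matrix (Fin m) (Fin p) ℂ, IsOrderedSpectralDecomposition (zᴴ * z) (U z) (ℓ z)) :
    Continuous ℓ := by
  refine continuous_pi fun k => continuous_iff_continuousAt.2 fun z => ?_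
  rw [ContinuousAt, tendsto_iff_norm_sub_tendsto_zero]
  have h2 : Tendsto (fun z' : Matrix (Fin m) (Fin p) ℂ => √(sqNorm (zᴴ * z - z'ᴴ * z')))
      (𝓝 z) (𝓝 0) := by
    simpa using (tendsto_sqNorm_gram_sub z).sqrt
  refine squeeze_zero (fun _ => norm_nonneg _) (fun z' => Real.le_sqrt_of_sq_le ?_) h2
  rw [Real.norm_eq_abs, sq_abs, sub_sq_comm]
  exact (hUℓ z).sub_sq_le (hUℓ z') k

/-- Individual eigenvectors have an arbitrary phase and need not be continuous. The projections are,
because the gap to the other eigenvalues stays away from zero. -/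
lemma tendsto_specProj
    (hUℓ : ∀ z : Matrix (Fin m) (Fin p) ℂ, IsOrderedSpectralDecomposition (zᴴ * z) (U z) (ℓ z))
    {z : Matrix (Fin m) (Fin p) ℂ} (hz : IsSimplePos (ℓ z)) (k : Fin p) :
    Tendsto (fun z' => specProj (U z') k) (𝓝 z) (𝓝 (specProj (U z) k)) := by
  have hℓ : ∀ k, Tendsto (fun z' => ℓ z' k) (𝓝 z) (𝓝 (ℓ z k)) := fun k =>
    ((continuous_apply k).comp (continuous_eigenvalue hUℓ)).tendsto z
  have hne : ∀ᶠ z' in 𝓝 z, ∀ j, j ≠ k → ℓ z j ≠ ℓ z' k := by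
    refine eventually_all.2 fun j => ?_
    by_cases hjk : j = k
    · exact .of_forall fun _ h => absurd hjk h
    · filter_upwards [(hℓ k).eventually_ne (hz.ne hjk).symm] with z' h _ using h.symm
  apply tendsto_of_tendsto_sqNorm_sub
  have hlim : Tendsto (fun z' : Matrix (Fin m) (Fin p) ℂ => 2 * ∑ j ∈ Finset.univ.erase k,
      sqNorm (zᴴ * z - z'ᴴ * z') / (ℓ z j - ℓ z' k) ^ 2) (𝓝 z)
      (𝓝 (2 * ∑ j ∈ Finset.univ.erase k, 0 / (ℓ z j - ℓ z k) ^ 2)) := by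
    refine Tendsto.const_mul _ (tendsto_finsetSum _ fun j hj => ?_)
    refine (tendsto_sqNorm_gram_sub z).div ((tendsto_const_nhds.sub (hℓ k)).pow 2) ?_
    exact pow_ne_zero _ (sub_ne_zero.2 (hz.ne (Finset.ne_of_mem_erase hj)))
  simp only [zero_div, Finset.sum_const_zero, mul_zero] at hlim
  refine squeeze_zero' (.of_forall fun _ => sqNorm_nonneg _) ?_ hlim
  filter_upwards [hne] with z' h
  exact (hUℓ z).sqNorm_specProj_sub_le (hUℓ z') k h

lemma tendsto_specFun
    (hUℓ : ∀ z : Matrix (Fin m) (Fin p) ℂ, IsOrderedSpectralDecomposition (zᴴ * z) (U z) (ℓ z))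
    {z : Matrix (Fin m) (Fin p) ℂ} (hz : IsSimplePos (ℓ z)) (c : Fin p → ℝ) :
    Tendsto (fun z' => specFun c (U z') (ℓ z')) (𝓝 z) (𝓝 (specFun c (U z) (ℓ z))) := by
  refine tendsto_finsetSum _ fun k _ => Tendsto.smul ?_ (tendsto_specProj hUℓ hz k)
  refine (Complex.continuous_ofReal.tendsto _).comp (tendsto_const_nhds.div ?_ (hz.2 k).ne')
  exact ((continuous_apply k).comp (continuous_eigenvalue hUℓ)).tendsto z

lemma tendsto_line (z v : Matrix (Fin m) (Fin p) ℂ) :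
    Tendsto (fun t : ℝ => z + t • v) (𝓝[≠] 0) (𝓝 z) := by
  have h : Continuous fun t : ℝ => z + t • v :=
    continuous_const.add (continuous_id.smul continuous_const)
  have := h.tendsto 0
  simp only [zero_smul, add_zero] at this
  exact this.mono_left nhdsWithin_le_nhds

/-- The derivative of `specFun c` in the direction `v`. -/
def specFunDeriv (c : Fin p → ℝ) (U : Matrix (Fin p) (Fin p) ℂ) (ℓ : Fin p → ℝ)
    (z v : Matrix (Fin m) (Fin p) ℂ) : Matrix (Fin p) (Fin p) ℂ :=
  ∑ j, ∑ k, (mixedDivDiff c ℓ ℓ j k : ℂ) • (specProj U j * gramDeriv z v * specProj U k)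

lemma tendsto_gram_quotient (z v : Matrix (Fin m) (Fin p) ℂ) :
    Tendsto (fun t : ℝ => gramDeriv z v + t • (vᴴ * v)) (𝓝[≠] 0) (𝓝 (gramDeriv z v)) :=
  (tendsto_line (gramDeriv z v) (vᴴ * v))

lemma tendsto_mixedDivDiff {α : Type*} {f : Filter α} (c : Fin p → ℝ) {l : Fin p → ℝ}
    (hl : IsSimplePos l) {g g' : α → Fin p → ℝ} (hg : Tendsto g f (𝓝 l))
    (hg' : Tendsto g' f (𝓝 l)) (j k : Fin p) :
    Tendsto (fun x => mixedDivDiff c (g x) (g' x) j k) f (𝓝 (mixedDivDiff c l l j k)) := by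
  have h1 := tendsto_pi_nhds.1 hg
  have h2 := tendsto_pi_nhds.1 hg'
  unfold mixedDivDiff
  split_ifs with hjk
  · exact tendsto_const_nhds.div ((h1 k).mul (h2 k)) (mul_pos (hl.2 k) (hl.2 k)).ne'
  · exact ((tendsto_const_nhds.div (h1 j) (hl.2 j).ne').sub
      (tendsto_const_nhds.div (h2 k) (hl.2 k).ne')).div ((h2 k).sub (h1 j))
      (sub_ne_zero.2 (hl.ne hjk).symm)

lemma hasDerivAt_specFun
    (hUℓ : ∀ z : Matrix (Fin m) (Fin p) ℂ, IsOrderedSpectralDecomposition (zᴴ * z) (U z) (ℓ z))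
    {z : Matrix (Fin m) (Fin p) ℂ} (hz : IsSimplePos (ℓ z)) (c : Fin p → ℝ)
    (v : Matrix (Fin m) (Fin p) ℂ) (a b : Fin p) :
    HasDerivAt (fun t : ℝ => specFun c (U (z + t • v)) (ℓ (z + t • v)) a b)
      (specFunDeriv c (U z) (ℓ z) z v a b) 0 := by
  have hlin := tendsto_line z v
  have hℓ : Tendsto (fun t : ℝ => ℓ (z + t • v)) (𝓝[≠] 0) (𝓝 (ℓ z)) :=
    ((continuous_eigenvalue hUℓ).tendsto z).comp hlin
  have hℓk := tendsto_pi_nhds.1 hℓ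
  have key : Tendsto (fun t : ℝ => ∑ j, ∑ k, (mixedDivDiff c (ℓ z) (ℓ (z + t • v)) j k : ℂ) •
      (specProj (U z) j * (gramDeriv z v + t • (vᴴ * v)) * specProj (U (z + t • v)) k))
      (𝓝[≠] 0) (𝓝 (specFunDeriv c (U z) (ℓ z) z v)) := by
    refine tendsto_finsetSum _ fun j _ => tendsto_finsetSum _ fun k _ => Tendsto.smul ?_ ?_
    · exact (Complex.continuous_ofReal.tendsto _).comp
        (tendsto_mixedDivDiff c hz tendsto_const_nhds hℓ j k)
    · exact (tendsto_const_nhds.matrix_mul_matrix (tendsto_gram_quotient z v)).matrix_mul_matrix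
        ((tendsto_specProj hUℓ hz k).comp hlin)
  rw [hasDerivAt_iff_tendsto_slope]
  refine (key.matrix_apply a b).congr' ?_
  have hne : ∀ᶠ t : ℝ in 𝓝[≠] 0, ∀ j k, j ≠ k → ℓ z j ≠ ℓ (z + t • v) k := by
    refine eventually_all.2 fun j => eventually_all.2 fun k => ?_
    by_cases hjk : j = k
    · exact .of_forall fun _ h => absurd hjk h
    · filter_upwards [(hℓk k).eventually_ne (hz.ne hjk).symm] with t h _ using h.symm
  have h0 : ∀ᶠ t : ℝ in 𝓝[≠] 0, ∀ k, ℓ (z + t • v) k ≠ 0 :=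
    eventually_all.2 fun k => (hℓk k).eventually_ne (hz.2 k).ne'
  filter_upwards [hne, h0, self_mem_nhdsWithin] with t h1 h2 ht
  have ht : t ≠ 0 := ht
  have e := specFun_sub_specFun (hUℓ z) (hUℓ (z + t • v)) h1 (fun k => (hz.2 k).ne') h2 c
  rw [gram_add_smul_sub] at e
  have e2 := congrFun (congrFun e a) b
  rw [slope_def_module, sub_zero, zero_smul, add_zero, ← Matrix.sub_apply, e2,
    ← Matrix.smul_apply, Finset.smul_sum]
  refine congrFun (congrFun ?_ a) b
  refine Finset.sum_congr rfl fun j _ => ?_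
  rw [Finset.smul_sum]
  refine Finset.sum_congr rfl fun k _ => ?_
  rw [Matrix.mul_smul, Matrix.smul_mul, smul_comm t⁻¹, smul_smul t⁻¹, inv_mul_cancel₀ ht, one_smul]

/-- The derivative of the eigenvalues in the direction `v`. -/
def eigenvalueDeriv (U : Matrix (Fin p) (Fin p) ℂ) (z v : Matrix (Fin m) (Fin p) ℂ)
    (k : Fin p) : ℝ := (specProj U k * gramDeriv z v).trace.re

/-- Sandwiching the increment of `zᴴ * z` between the old and the new `k`-th projection multiplies
their product by `ℓ' k - ℓ k`. Dividing traces is legitimate near `0`, since the trace of that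
product tends to one. -/
lemma hasDerivAt_eigenvalue
    (hUℓ : ∀ z : Matrix (Fin m) (Fin p) ℂ, IsOrderedSpectralDecomposition (zᴴ * z) (U z) (ℓ z))
    {z : Matrix (Fin m) (Fin p) ℂ} (hz : IsSimplePos (ℓ z)) (v : Matrix (Fin m) (Fin p) ℂ) :
    HasDerivAt (fun t : ℝ => ℓ (z + t • v)) (eigenvalueDeriv (U z) z v) 0 := by
  refine hasDerivAt_pi.2 fun k => ?_
  have hlin := tendsto_line z v
  have hP := (tendsto_specProj hUℓ hz k).comp hlin
  have h1 : Tendsto (fun t : ℝ => (specProj (U z) k * specProj (U (z + t • v)) k).trace) (𝓝[≠] 0)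
      (𝓝 1) := by
    have := ((tendsto_const_nhds (x := specProj (U z) k)).matrix_mul_matrix hP).matrix_trace'
    rwa [specProj_mul_specProj (hUℓ z).unitary, if_pos rfl, trace_specProj (hUℓ z).unitary] at this
  have h2 : Tendsto (fun t : ℝ => ((specProj (U z) k * (gramDeriv z v + t • (vᴴ * v)) *
      specProj (U (z + t • v)) k).trace /
      (specProj (U z) k * specProj (U (z + t • v)) k).trace).re) (𝓝[≠] 0)
      (𝓝 (eigenvalueDeriv (U z) z v k)) := by
    have h3 := ((tendsto_const_nhds (x := specProj (U z) k)).matrix_mul_matrix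
      (tendsto_gram_quotient z v)).matrix_mul_matrix hP
    have h4 := (Complex.continuous_re.tendsto _).comp (h3.matrix_trace'.div h1 one_ne_zero)
    rw [div_one, Matrix.trace_mul_comm, ← Matrix.mul_assoc,
      specProj_mul_specProj (hUℓ z).unitary, if_pos rfl] at h4
    exact h4
  rw [hasDerivAt_iff_tendsto_slope]
  refine h2.congr' ?_
  filter_upwards [h1.eventually_ne one_ne_zero, self_mem_nhdsWithin] with t h3 ht
  have ht : t ≠ 0 := ht
  have e : specProj (U z) k * ((z + t • v)ᴴ * (z + t • v) - zᴴ * z) * specProj (U (z + t • v)) k =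
      ((ℓ (z + t • v) k - ℓ z k : ℝ) : ℂ) • (specProj (U z) k * specProj (U (z + t • v)) k) := by
    rw [mul_sub, sub_mul, (hUℓ z).specProj_mul_self, mul_assoc,
      (hUℓ (z + t • v)).self_mul_specProj, Matrix.mul_smul, Matrix.smul_mul, ← sub_smul]
    push_cast
    rfl
  rw [gram_add_smul_sub, Matrix.mul_smul, Matrix.smul_mul] at e
  have e2 := congrArg Matrix.trace e
  rw [Matrix.trace_smul, Matrix.trace_smul, smul_eq_mul, Complex.real_smul] at e2
  have e3 : (specProj (U z) k * (gramDeriv z v + t • (vᴴ * v)) *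
      specProj (U (z + t • v)) k).trace /
      (specProj (U z) k * specProj (U (z + t • v)) k).trace =
      ((t⁻¹ * (ℓ (z + t • v) k - ℓ z k) : ℝ) : ℂ) := by
    rw [div_eq_iff h3]
    have ht' : (t : ℂ) ≠ 0 := Complex.ofReal_ne_zero.2 ht
    push_cast at e2 ⊢
    rw [mul_assoc (t : ℂ)⁻¹, ← e2, inv_mul_cancel_left₀ ht']
  rw [e3, Complex.ofReal_re, slope_def_module, sub_zero, zero_smul, add_zero, smul_eq_mul]

end SpectralCalculus

/-! ### A `C¹` cutoff in the eigenvalues whose derivative has a favourable sign. -/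

section Cutoff

open Filter Topology

variable {p : ℕ}

lemma expNegInvGlue_le_one (x : ℝ) : expNegInvGlue x ≤ 1 := by
  unfold expNegInvGlue
  split_ifs with h
  · exact zero_le_one
  · rw [Real.exp_le_one_iff, neg_nonpos, inv_nonneg]
    exact (not_le.1 h).le

lemma hasDerivAt_expNegInvGlue (x : ℝ) :
    HasDerivAt expNegInvGlue (x⁻¹ ^ 2 * expNegInvGlue x) x := by
  simpa using expNegInvGlue.hasDerivAt_polynomial_eval_inv_mul 1 x

/-- With `y = x⁻¹` this is `y² exp (-y) ≤ 2`, from `exp y ≥ 1 + y + y² / 2`. It bounds the slope of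
the cutoff at infinity. -/
lemma inv_sq_mul_expNegInvGlue_le (x : ℝ) : x⁻¹ ^ 2 * expNegInvGlue x ≤ 2 := by
  rcases le_or_gt x 0 with h | h
  · simp [expNegInvGlue.zero_of_nonpos h]
  · have h1 := Real.quadratic_le_exp_of_nonneg (inv_nonneg.2 h.le)
    rw [expNegInvGlue, if_neg (not_le.2 h), Real.exp_neg, ← div_eq_mul_inv,
      div_le_iff₀ (Real.exp_pos _)]
    nlinarith [inv_pos.2 h]

lemma tendsto_expNegInvGlue_atTop : Tendsto expNegInvGlue atTop (𝓝 1) := by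
  have h : Tendsto (fun x : ℝ => Real.exp (-x⁻¹)) atTop (𝓝 1) := by
    have := (Real.continuous_exp.tendsto _).comp (tendsto_inv_atTop_zero (𝕜 := ℝ)).neg
    simpa [Function.comp_def] using this
  refine h.congr' ?_
  filter_upwards [eventually_gt_atTop 0] with x hx
  rw [expNegInvGlue, if_neg (not_le.2 hx)]

/-- A smooth cutoff of the region where the gaps between consecutive values (and the values
themselves) are not small. -/
def gapCutoff (r : ℝ) (l : Fin p → ℝ) : ℝ :=
  (∏ i, ∏ j, if i < j then expNegInvGlue (r * (l i - l j) - 1) else 1) *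
    ∏ k, expNegInvGlue (r * l k - 1)

/-- A smooth cutoff of the region where the gaps are not small and the sum is not large. -/
def cutoff (r : ℝ) (l : Fin p → ℝ) : ℝ := expNegInvGlue (r - (∑ k, l k) / r) * gapCutoff r l

lemma contDiff_gapCutoff (r : ℝ) : ContDiff ℝ 1 (gapCutoff r : (Fin p → ℝ) → ℝ) := by
  have hT : ContDiff ℝ 1 expNegInvGlue := expNegInvGlue.contDiff (n := 1)
  refine ContDiff.mul ?_ ?_
  · refine contDiff_prod fun i _ => contDiff_prod fun j _ => ?_
    split_ifs
    · exact hT.comp (by fun_prop)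
    · exact contDiff_const
  · exact contDiff_prod fun k _ => hT.comp (by fun_prop)

lemma contDiff_cutoff (r : ℝ) : ContDiff ℝ 1 (cutoff r : (Fin p → ℝ) → ℝ) := by
  have hT : ContDiff ℝ 1 expNegInvGlue := expNegInvGlue.contDiff (n := 1)
  refine ContDiff.mul (hT.comp ?_) (contDiff_gapCutoff r)
  exact contDiff_const.sub ((ContDiff.sum fun k _ => contDiff_apply ℝ ℝ k).div_const r)

lemma gapCutoff_nonneg (r : ℝ) (l : Fin p → ℝ) : 0 ≤ gapCutoff r l := by
  refine mul_nonneg (Finset.prod_nonneg fun i _ => Finset.prod_nonneg fun j _ => ?_)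
    (Finset.prod_nonneg fun k _ => expNegInvGlue.nonneg _)
  split_ifs
  · exact expNegInvGlue.nonneg _
  · exact zero_le_one

lemma gapCutoff_le_one (r : ℝ) (l : Fin p → ℝ) : gapCutoff r l ≤ 1 := by
  have h0 : ∀ i j : Fin p, 0 ≤ (if i < j then expNegInvGlue (r * (l i - l j) - 1) else 1) := by
    intro i j
    split_ifs
    · exact expNegInvGlue.nonneg _
    · exact zero_le_one
  refine mul_le_one₀ (Finset.prod_le_one (fun i _ => Finset.prod_nonneg fun j _ => h0 i j)
    fun i _ => Finset.prod_le_one (fun j _ => h0 i j) fun j _ => ?_)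
    (Finset.prod_nonneg fun k _ => expNegInvGlue.nonneg _)
    (Finset.prod_le_one (fun k _ => expNegInvGlue.nonneg _) fun k _ => expNegInvGlue_le_one _)
  split_ifs
  · exact expNegInvGlue_le_one _
  · exact le_rfl

lemma cutoff_nonneg (r : ℝ) (l : Fin p → ℝ) : 0 ≤ cutoff r l :=
  mul_nonneg (expNegInvGlue.nonneg _) (gapCutoff_nonneg r l)

lemma cutoff_le_one (r : ℝ) (l : Fin p → ℝ) : cutoff r l ≤ 1 :=
  mul_le_one₀ (expNegInvGlue_le_one _) (gapCutoff_nonneg r l) (gapCutoff_le_one r l)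

/-- The `- 1` in the arguments of `gapCutoff` leaves a margin: some factor has argument at most `-1`
at a bad point and so vanishes in a whole neighbourhood. -/
lemma eventually_cutoff_eq_zero (r : ℝ) (hr : 0 < r) {l : Fin p → ℝ} (hl : ¬IsSimplePos l) :
    ∀ᶠ l' in 𝓝 l, cutoff r l' = 0 := by
  have hl' : (∃ i j, i < j ∧ l i ≤ l j) ∨ ∃ k, l k ≤ 0 := by
    by_contra! h
    exact hl ⟨fun i j hij => h.1 i j hij, h.2⟩
  rcases hl' with ⟨i, j, hij, h⟩ | ⟨k, h⟩
  · have hc : Continuous fun l' : Fin p → ℝ => r * (l' i - l' j) - 1 := by fun_prop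
    have : ∀ᶠ l' in 𝓝 l, r * (l' i - l' j) - 1 < 0 := by
      refine hc.tendsto l (Iio_mem_nhds ?_)
      nlinarith
    filter_upwards [this] with l' h'
    rw [cutoff, gapCutoff, Finset.prod_eq_zero (Finset.mem_univ i), zero_mul, mul_zero]
    rw [Finset.prod_eq_zero (Finset.mem_univ j)]
    rw [if_pos hij, expNegInvGlue.zero_of_nonpos h'.le]
  · have hc : Continuous fun l' : Fin p → ℝ => r * l' k - 1 := by fun_prop
    have : ∀ᶠ l' in 𝓝 l, r * l' k - 1 < 0 := by
      refine hc.tendsto l (Iio_mem_nhds ?_)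
      nlinarith
    filter_upwards [this] with l' h'
    rw [cutoff, gapCutoff, Finset.prod_eq_zero (f := fun k => expNegInvGlue (r * l' k - 1))
      (Finset.mem_univ k) (expNegInvGlue.zero_of_nonpos h'.le), mul_zero, mul_zero]

lemma cutoff_eq_zero_of_le {r : ℝ} (hr : 0 < r) {l : Fin p → ℝ} (h : r ^ 2 ≤ ∑ k, l k) :
    cutoff r l = 0 := by
  rw [cutoff, expNegInvGlue.zero_of_nonpos, zero_mul]
  rw [sub_nonpos, le_div_iff₀ hr]
  nlinarith

lemma tendsto_cutoff {l : Fin p → ℝ} (hl : IsSimplePos l) :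
    Tendsto (fun n : ℕ => cutoff (n + 1 : ℝ) l) atTop (𝓝 1) := by
  have hn : Tendsto (fun n : ℕ => (n + 1 : ℝ)) atTop atTop :=
    tendsto_atTop_add_const_right _ _ tendsto_natCast_atTop_atTop
  have h1 : ∀ a : ℝ, 0 < a →
      Tendsto (fun n : ℕ => expNegInvGlue ((n + 1 : ℝ) * a - 1)) atTop (𝓝 1) := fun a ha =>
    tendsto_expNegInvGlue_atTop.comp
      (tendsto_atTop_add_const_right _ _ (hn.atTop_mul_const ha))
  have h2 : Tendsto (fun n : ℕ => expNegInvGlue ((n + 1 : ℝ) - (∑ k, l k) / (n + 1))) atTop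
      (𝓝 1) := by
    refine tendsto_expNegInvGlue_atTop.comp ?_
    refine hn.atTop_add (C := -0) ?_
    exact (tendsto_const_nhds.div_atTop hn).neg
  have h3 : Tendsto (fun n : ℕ => ∏ i : Fin p, ∏ j : Fin p,
      if i < j then expNegInvGlue ((n + 1 : ℝ) * (l i - l j) - 1) else 1) atTop
      (𝓝 (∏ _i : Fin p, ∏ _j : Fin p, 1)) := by
    refine tendsto_finsetProd _ fun i _ => tendsto_finsetProd _ fun j _ => ?_
    split_ifs with hij
    · exact h1 _ (sub_pos.2 (hl.1 hij))
    · exact tendsto_const_nhds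
  have h4 : Tendsto (fun n : ℕ => ∏ k : Fin p, expNegInvGlue ((n + 1 : ℝ) * l k - 1)) atTop
      (𝓝 (∏ _k : Fin p, 1)) := tendsto_finsetProd _ fun k _ => h1 _ (hl.2 k)
  have := h2.mul (h3.mul h4)
  simpa [cutoff, gapCutoff] using this

/-- Moving along a direction that decreases all gaps decreases the gap cutoff. -/
lemma antitone_gapCutoff_line {r : ℝ} (hr : 0 < r) {c : Fin p → ℝ} (hc : Antitone c)
    (h0 : ∀ k, 0 ≤ c k) (l : Fin p → ℝ) : Antitone fun s : ℝ => gapCutoff r (l - s • c) := by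
  intro s t hst
  have hi : ∀ i j : Fin p, 0 ≤ (if i < j then
      expNegInvGlue (r * ((l - t • c) i - (l - t • c) j) - 1) else 1) := by
    intro i j
    split_ifs
    · exact expNegInvGlue.nonneg _
    · exact zero_le_one
  refine mul_le_mul (Finset.prod_le_prod (fun i _ => Finset.prod_nonneg fun j _ => hi i j)
    fun i _ => Finset.prod_le_prod (fun j _ => hi i j) fun j _ => ?_)
    (Finset.prod_le_prod (fun k _ => expNegInvGlue.nonneg _) fun k _ => ?_)
    (Finset.prod_nonneg fun k _ => expNegInvGlue.nonneg _)
    (Finset.prod_nonneg fun i _ => Finset.prod_nonneg fun j _ => ?_)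
  · split_ifs with hij
    · refine expNegInvGlue.monotone (sub_le_sub_right (mul_le_mul_of_nonneg_left ?_ hr.le) 1)
      simp only [Pi.sub_apply, Pi.smul_apply, smul_eq_mul]
      nlinarith [hc hij.le]
    · exact le_rfl
  · refine expNegInvGlue.monotone (sub_le_sub_right (mul_le_mul_of_nonneg_left ?_ hr.le) 1)
    simp only [Pi.sub_apply, Pi.smul_apply, smul_eq_mul]
    nlinarith [h0 k]
  · split_ifs
    · exact expNegInvGlue.nonneg _
    · exact zero_le_one

/-- The estimate that makes truncation harmless. The gap factor is nonincreasing along `-c`, so its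
derivative is discarded. The remaining factor has an argument of slope `(∑ k, c k) / r` and is
differentiated at cost at most `2`. No bound on the derivative near the singular set is needed. -/
lemma fderiv_cutoff_neg_le {r : ℝ} (hr : 0 < r) {c : Fin p → ℝ} (hc : Antitone c)
    (h0 : ∀ k, 0 ≤ c k) (l : Fin p → ℝ) :
    fderiv ℝ (cutoff r) l (-c) ≤ 2 * (∑ k, c k) / r := by
  have hline : HasDerivAt (fun s : ℝ => l - s • c) (-c) 0 := by
    simpa using ((hasDerivAt_id (0 : ℝ)).smul_const c).const_sub l
  have hl0 : l - (0 : ℝ) • c = l := by simp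
  have h1 : HasDerivAt (fun s : ℝ => cutoff r (l - s • c)) (fderiv ℝ (cutoff r) l (-c)) 0 := by
    have := ((contDiff_cutoff (p := p) r).differentiable one_ne_zero l).hasFDerivAt
    rw [← hl0] at this
    have h2 := this.comp_hasDerivAt (0 : ℝ) hline
    rw [hl0] at h2
    exact h2
  have h2 : HasDerivAt (fun s : ℝ => gapCutoff r (l - s • c)) (fderiv ℝ (gapCutoff r) l (-c)) 0 := by
    have := ((contDiff_gapCutoff (p := p) r).differentiable one_ne_zero l).hasFDerivAt
    rw [← hl0] at this
    have h2 := this.comp_hasDerivAt (0 : ℝ) hline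
    rw [hl0] at h2
    exact h2
  have h2' : fderiv ℝ (gapCutoff r) l (-c) ≤ 0 := by
    rw [← h2.deriv]
    exact (antitone_gapCutoff_line hr hc h0 l).deriv_nonpos
  have h3 : HasDerivAt (fun s : ℝ => r - (∑ k, (l - s • c) k) / r) ((∑ k, c k) / r) 0 := by
    have e : (fun s : ℝ => r - (∑ k, (l - s • c) k) / r) =
        fun s => s * ((∑ k, c k) / r) + (r - (∑ k, l k) / r) := by
      funext s
      simp only [Pi.sub_apply, Pi.smul_apply, smul_eq_mul, Finset.sum_sub_distrib,
        ← Finset.mul_sum]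
      ring
    rw [e]
    simpa using ((hasDerivAt_id (0 : ℝ)).mul_const ((∑ k, c k) / r)).add_const
      (r - (∑ k, l k) / r)
  set x := r - (∑ k, (l - (0 : ℝ) • c) k) / r
  have h4 : HasDerivAt (fun s : ℝ => expNegInvGlue (r - (∑ k, (l - s • c) k) / r))
      (x⁻¹ ^ 2 * expNegInvGlue x * ((∑ k, c k) / r)) 0 :=
    HasDerivAt.comp (0 : ℝ) (h₂ := expNegInvGlue) (hasDerivAt_expNegInvGlue x) h3
  have h5 := h1.unique (h4.mul h2)
  rw [h5]
  have hS : 0 ≤ (∑ k, c k) / r := div_nonneg (Finset.sum_nonneg fun k _ => h0 k) hr.le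
  have hx := inv_sq_mul_expNegInvGlue_le x
  have hx0 : 0 ≤ x⁻¹ ^ 2 * expNegInvGlue x := mul_nonneg (sq_nonneg _) (expNegInvGlue.nonneg _)
  have a1 : x⁻¹ ^ 2 * expNegInvGlue x * ((∑ k, c k) / r) * gapCutoff r (l - (0 : ℝ) • c) ≤
      x⁻¹ ^ 2 * expNegInvGlue x * ((∑ k, c k) / r) :=
    mul_le_of_le_one_right (mul_nonneg hx0 hS) (gapCutoff_le_one r _)
  have a2 : x⁻¹ ^ 2 * expNegInvGlue x * ((∑ k, c k) / r) ≤ 2 * ((∑ k, c k) / r) :=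
    mul_le_mul_of_nonneg_right hx hS
  have a3 : expNegInvGlue x * fderiv ℝ (gapCutoff r) l (-c) ≤ 0 :=
    mul_nonpos_of_nonneg_of_nonpos (expNegInvGlue.nonneg _) h2'
  rw [mul_div_assoc]
  linarith

end Cutoff

/-! ### The truncated shrinkage field: directional differentiability, continuity, compact support.
-/

section VectorField

open Filter Topology

variable {m p : ℕ} {U : Matrix (Fin m) (Fin p) ℂ → Matrix (Fin p) (Fin p) ℂ}
  {ℓ : Matrix (Fin m) (Fin p) ℂ → Fin p → ℝ}

/-- The truncated shrinkage term. -/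
def shrinkField (r : ℝ) (c : Fin p → ℝ) (U : Matrix (Fin m) (Fin p) ℂ → Matrix (Fin p) (Fin p) ℂ)
    (ℓ : Matrix (Fin m) (Fin p) ℂ → Fin p → ℝ) (z : Matrix (Fin m) (Fin p) ℂ) :
    Matrix (Fin m) (Fin p) ℂ :=
  (cutoff r (ℓ z) : ℂ) • (z * specFun c (U z) (ℓ z))

/-- The derivative of `shrinkField` in the direction `v`. -/
def shrinkFieldDeriv (r : ℝ) (c : Fin p → ℝ)
    (U : Matrix (Fin m) (Fin p) ℂ → Matrix (Fin p) (Fin p) ℂ)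
    (ℓ : Matrix (Fin m) (Fin p) ℂ → Fin p → ℝ) (v z : Matrix (Fin m) (Fin p) ℂ) :
    Matrix (Fin m) (Fin p) ℂ :=
  (cutoff r (ℓ z) : ℂ) • (v * specFun c (U z) (ℓ z) + z * specFunDeriv c (U z) (ℓ z) z v) +
    (fderiv ℝ (cutoff r) (ℓ z) (eigenvalueDeriv (U z) z v) : ℂ) • (z * specFun c (U z) (ℓ z))

lemma eventually_fderiv_cutoff_eq_zero {r : ℝ} (hr : 0 < r) {l : Fin p → ℝ}
    (hl : ¬IsSimplePos l) : ∀ᶠ l' in 𝓝 l, fderiv ℝ (cutoff r) l' = 0 := by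
  filter_upwards [(eventually_cutoff_eq_zero r hr hl).eventually_nhds] with l' h
  have : cutoff r =ᶠ[𝓝 l'] fun _ => (0 : ℝ) := h
  rw [this.fderiv_eq]
  simp

/-- At a simple positive spectrum this is the product rule. Elsewhere the field vanishes nearby, and
the formula for the derivative also gives zero because both the cutoff and its derivative vanish. -/
lemma hasDerivAt_shrinkField
    (hUℓ : ∀ z : Matrix (Fin m) (Fin p) ℂ, IsOrderedSpectralDecomposition (zᴴ * z) (U z) (ℓ z))
    {r : ℝ} (hr : 0 < r) (c : Fin p → ℝ) (v z : Matrix (Fin m) (Fin p) ℂ) (i : Fin m)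
    (j : Fin p) :
    HasDerivAt (fun t : ℝ => shrinkField r c U ℓ (z + t • v) i j)
      (shrinkFieldDeriv r c U ℓ v z i j) 0 := by
  by_cases hz : IsSimplePos (ℓ z)
  · have e0 : z + (0 : ℝ) • v = z := by simp
    have h1 : HasDerivAt (fun t : ℝ => cutoff r (ℓ (z + t • v)))
        (fderiv ℝ (cutoff r) (ℓ z) (eigenvalueDeriv (U z) z v)) 0 := by
      have h := ((contDiff_cutoff (p := p) r).differentiable one_ne_zero
        (ℓ (z + (0 : ℝ) • v))).hasFDerivAt
      have h2 := h.comp_hasDerivAt (0 : ℝ) (hasDerivAt_eigenvalue hUℓ hz v)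
      rw [e0] at h2
      exact h2
    have h2 : HasDerivAt (fun t : ℝ => ((z + t • v) * specFun c (U (z + t • v)) (ℓ (z + t • v))) i j)
        ((v * specFun c (U z) (ℓ z) + z * specFunDeriv c (U z) (ℓ z) z v) i j) 0 := by
      simp only [Matrix.mul_apply, Matrix.add_apply, ← Finset.sum_add_distrib]
      refine HasDerivAt.fun_sum fun k _ => ?_
      have a1 : HasDerivAt (fun t : ℝ => z i k + (t • v) i k) (v i k) 0 := by
        have := ((hasDerivAt_id (0 : ℝ)).smul_const (v i k)).const_add (z i k)
        simpa using this
      have a2 := a1.mul (hasDerivAt_specFun hUℓ hz c v k j)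
      simp only [zero_smul, Matrix.zero_apply, add_zero] at a2
      exact a2
    have h3 := h1.ofReal_comp.mul h2
    simp only [e0] at h3
    refine h3.congr_deriv ?_
    simp only [shrinkFieldDeriv, Matrix.add_apply, Matrix.smul_apply, smul_eq_mul]
    ring
  · have hc := continuous_eigenvalue hUℓ
    have e1 : ∀ᶠ z' in 𝓝 z, cutoff r (ℓ z') = 0 :=
      (hc.tendsto z).eventually (eventually_cutoff_eq_zero r hr hz)
    have e2 : fderiv ℝ (cutoff r) (ℓ z) = 0 :=
      (eventually_fderiv_cutoff_eq_zero hr hz).self_of_nhds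
    have hline : Tendsto (fun t : ℝ => z + t • v) (𝓝 0) (𝓝 z) := by
      have h : Continuous fun t : ℝ => z + t • v :=
        continuous_const.add (continuous_id.smul continuous_const)
      simpa using h.tendsto 0
    have e3 : shrinkFieldDeriv r c U ℓ v z i j = 0 := by
      simp [shrinkFieldDeriv, e1.self_of_nhds, e2]
    rw [e3]
    refine (hasDerivAt_const (0 : ℝ) (0 : ℂ)).congr_of_eventuallyEq ?_
    filter_upwards [hline.eventually e1] with t ht
    simp [shrinkField, ht]

lemma continuous_shrinkField
    (hUℓ : ∀ z : Matrix (Fin m) (Fin p) ℂ, IsOrderedSpectralDecomposition (zᴴ * z) (U z) (ℓ z))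
    {r : ℝ} (hr : 0 < r) (c : Fin p → ℝ) : Continuous (shrinkField r c U ℓ) := by
  refine continuous_iff_continuousAt.2 fun z => ?_
  have hc := continuous_eigenvalue hUℓ
  by_cases hz : IsSimplePos (ℓ z)
  · exact Tendsto.smul ((Complex.continuous_ofReal.comp
      ((contDiff_cutoff r).continuous.comp hc)).tendsto z)
      (tendsto_id.matrix_mul_matrix (tendsto_specFun hUℓ hz c))
  · have e1 : ∀ᶠ z' in 𝓝 z, cutoff r (ℓ z') = 0 :=
      (hc.tendsto z).eventually (eventually_cutoff_eq_zero r hr hz)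
    have : shrinkField r c U ℓ =ᶠ[𝓝 z] fun _ => 0 := by
      filter_upwards [e1] with z' h
      simp [shrinkField, h]
    exact continuousAt_const.congr this.symm

lemma tendsto_gramDeriv (v z : Matrix (Fin m) (Fin p) ℂ) :
    Tendsto (fun z' => gramDeriv z' v) (𝓝 z) (𝓝 (gramDeriv z v)) := by
  have : Continuous fun z' : Matrix (Fin m) (Fin p) ℂ => gramDeriv z' v :=
    (continuous_const.matrix_mul continuous_id).add
      (continuous_id.matrix_conjTranspose.matrix_mul continuous_const)
  exact this.tendsto z

lemma continuous_shrinkFieldDeriv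
    (hUℓ : ∀ z : Matrix (Fin m) (Fin p) ℂ, IsOrderedSpectralDecomposition (zᴴ * z) (U z) (ℓ z))
    {r : ℝ} (hr : 0 < r) (c : Fin p → ℝ) (v : Matrix (Fin m) (Fin p) ℂ) :
    Continuous (shrinkFieldDeriv r c U ℓ v) := by
  refine continuous_iff_continuousAt.2 fun z => ?_
  have hc := continuous_eigenvalue hUℓ
  by_cases hz : IsSimplePos (ℓ z)
  · have h1 : Tendsto (fun z' => (cutoff r (ℓ z') : ℂ)) (𝓝 z) (𝓝 (cutoff r (ℓ z) : ℂ)) :=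
      (Complex.continuous_ofReal.comp ((contDiff_cutoff r).continuous.comp hc)).tendsto z
    have h2 := tendsto_specFun hUℓ hz c
    have h3 : Tendsto (fun z' => specFunDeriv c (U z') (ℓ z') z' v) (𝓝 z)
        (𝓝 (specFunDeriv c (U z) (ℓ z) z v)) := by
      refine tendsto_finsetSum _ fun j _ => tendsto_finsetSum _ fun k _ => Tendsto.smul ?_ ?_
      · exact (Complex.continuous_ofReal.tendsto _).comp
          (tendsto_mixedDivDiff c hz (hc.tendsto z) (hc.tendsto z) j k)
      · exact ((tendsto_specProj hUℓ hz j).matrix_mul_matrix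
          (tendsto_gramDeriv v z)).matrix_mul_matrix (tendsto_specProj hUℓ hz k)
    have h4 : Tendsto (fun z' => eigenvalueDeriv (U z') z' v) (𝓝 z)
        (𝓝 (eigenvalueDeriv (U z) z v)) := by
      refine tendsto_pi_nhds.2 fun k => ?_
      exact (Complex.continuous_re.tendsto _).comp
        ((tendsto_specProj hUℓ hz k).matrix_mul_matrix (tendsto_gramDeriv v z)).matrix_trace'
    have h5 : Tendsto (fun z' => fderiv ℝ (cutoff r) (ℓ z')) (𝓝 z)
        (𝓝 (fderiv ℝ (cutoff r) (ℓ z))) :=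
      (((contDiff_cutoff r).continuous_fderiv one_ne_zero).comp hc).tendsto z
    have h6 := (Complex.continuous_ofReal.tendsto _).comp (ContinuousAt.clm_apply h5 h4)
    exact (h1.smul ((tendsto_const_nhds.matrix_mul_matrix h2).add
      (tendsto_id.matrix_mul_matrix h3))).add (h6.smul (tendsto_id.matrix_mul_matrix h2))
  · have e1 : ∀ᶠ z' in 𝓝 z, cutoff r (ℓ z') = 0 :=
      (hc.tendsto z).eventually (eventually_cutoff_eq_zero r hr hz)
    have e2 : ∀ᶠ z' in 𝓝 z, fderiv ℝ (cutoff r) (ℓ z') = 0 :=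
      (hc.tendsto z).eventually (eventually_fderiv_cutoff_eq_zero hr hz)
    have : shrinkFieldDeriv r c U ℓ v =ᶠ[𝓝 z] fun _ => 0 := by
      filter_upwards [e1, e2] with z' h h'
      simp [shrinkFieldDeriv, h, h']
    exact continuousAt_const.congr this.symm

lemma sum_eigenvalue {z : Matrix (Fin m) (Fin p) ℂ} {U : Matrix (Fin p) (Fin p) ℂ}
    {ℓ : Fin p → ℝ} (h : IsOrderedSpectralDecomposition (zᴴ * z) U ℓ) :
    ∑ k, ℓ k = sqNorm z := by
  rw [sqNorm_eq_trace, h.eq_sum, Matrix.trace_sum]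
  simp [trace_specProj h.unitary]

lemma eigenvalue_nonneg {z : Matrix (Fin m) (Fin p) ℂ} {U : Matrix (Fin p) (Fin p) ℂ}
    {ℓ : Fin p → ℝ} (h : IsOrderedSpectralDecomposition (zᴴ * z) U ℓ) (k : Fin p) : 0 ≤ ℓ k := by
  have h1 : sqNorm (z * specProj U k) = ℓ k := by
    rw [sqNorm_eq_trace, Matrix.conjTranspose_mul, conjTranspose_specProj]
    have : specProj U k * zᴴ * (z * specProj U k) = specProj U k * ((zᴴ * z) * specProj U k) := by
      simp only [Matrix.mul_assoc]
    rw [this, h.self_mul_specProj, Matrix.mul_smul, specProj_mul_specProj h.unitary, if_pos rfl,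
      Matrix.trace_smul, trace_specProj h.unitary]
    simp
  rw [← h1]
  exact sqNorm_nonneg _

lemma norm_le_sqrt_sqNorm (z : Fin m → Fin p → ℂ) : ‖z‖ ≤ √(sqNorm z) := by
  refine (pi_norm_le_iff_of_nonneg (Real.sqrt_nonneg _)).2 fun i =>
    (pi_norm_le_iff_of_nonneg (Real.sqrt_nonneg _)).2 fun j => Real.le_sqrt_of_sq_le ?_
  exact (Finset.single_le_sum (f := fun j => ‖z i j‖ ^ 2) (fun _ _ => by positivity)
    (Finset.mem_univ j)).trans (Finset.single_le_sum (f := fun i => ∑ j, ‖z i j‖ ^ 2)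
    (fun _ _ => by positivity) (Finset.mem_univ i))

/-- The eigenvalues sum to the squared Frobenius norm, which dominates the sup norm. Thus the
truncated field is supported in the sup-norm ball of radius `r`. -/
lemma cutoff_eq_zero_of_norm_le
    (hUℓ : ∀ z : Matrix (Fin m) (Fin p) ℂ, IsOrderedSpectralDecomposition (zᴴ * z) (U z) (ℓ z))
    {r : ℝ} (hr : 0 < r) {z : Fin m → Fin p → ℂ} (hz : r < ‖z‖) :
    cutoff r (ℓ z) = 0 ∧ fderiv ℝ (cutoff r) (ℓ z) = 0 := by
  have h1 : r ^ 2 < ∑ k, ℓ z k := by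
    rw [sum_eigenvalue (hUℓ z)]
    have := hz.trans_le (norm_le_sqrt_sqNorm z)
    exact (Real.lt_sqrt hr.le).1 this
  refine ⟨cutoff_eq_zero_of_le hr h1.le, ?_⟩
  have hcont : Continuous fun l : Fin p → ℝ => ∑ k, l k := by fun_prop
  have h2 : cutoff r =ᶠ[𝓝 (ℓ z)] fun _ => (0 : ℝ) := by
    filter_upwards [hcont.tendsto (ℓ z) (Ioi_mem_nhds h1)] with l hl
    exact cutoff_eq_zero_of_le hr (le_of_lt hl)
  rw [h2.fderiv_eq]
  simp

lemma shrinkField_eq_zero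
    (hUℓ : ∀ z : Matrix (Fin m) (Fin p) ℂ, IsOrderedSpectralDecomposition (zᴴ * z) (U z) (ℓ z))
    {r : ℝ} (hr : 0 < r) (c : Fin p → ℝ) {z : Fin m → Fin p → ℂ} (hz : r < ‖z‖) :
    shrinkField r c U ℓ z = 0 := by
  simp [shrinkField, (cutoff_eq_zero_of_norm_le hUℓ hr hz).1]

lemma shrinkFieldDeriv_eq_zero
    (hUℓ : ∀ z : Matrix (Fin m) (Fin p) ℂ, IsOrderedSpectralDecomposition (zᴴ * z) (U z) (ℓ z))
    {r : ℝ} (hr : 0 < r) (c : Fin p → ℝ) (v : Matrix (Fin m) (Fin p) ℂ)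
    {z : Fin m → Fin p → ℂ} (hz : r < ‖z‖) : shrinkFieldDeriv r c U ℓ v z = 0 := by
  obtain ⟨h1, h2⟩ := cutoff_eq_zero_of_norm_le hUℓ hr hz
  simp [shrinkFieldDeriv, h1, h2]

end VectorField

/-! ### Real divergences of the pieces of the field. -/

section Divergence

variable {m p : ℕ}

/-- The trace over the reals of a map between complex matrices. -/
def realDiv (T : Matrix (Fin m) (Fin p) ℂ → Matrix (Fin m) (Fin p) ℂ) : ℝ :=
  ∑ a : Fin m, ∑ b : Fin p,
    ((T (Matrix.single a b 1) a b).re + (T (Matrix.single a b Complex.I) a b).im)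

lemma realDiv_add (S T : Matrix (Fin m) (Fin p) ℂ → Matrix (Fin m) (Fin p) ℂ) :
    realDiv (fun v : Matrix (Fin m) (Fin p) ℂ => S v + T v) = realDiv S + realDiv T := by
  simp only [realDiv, Matrix.add_apply, Complex.add_re, Complex.add_im, ← Finset.sum_add_distrib]
  exact Finset.sum_congr rfl fun a _ => Finset.sum_congr rfl fun b _ => by ring

lemma realDiv_smul (x : ℝ) (T : Matrix (Fin m) (Fin p) ℂ → Matrix (Fin m) (Fin p) ℂ) :
    realDiv (fun v : Matrix (Fin m) (Fin p) ℂ => (x : ℂ) • T v) = x * realDiv T := by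
  simp only [realDiv, Matrix.smul_apply, smul_eq_mul, Complex.re_ofReal_mul, Complex.im_ofReal_mul,
    Finset.mul_sum, mul_add]

lemma realDiv_sum {ι : Type*} (s : Finset ι)
    (T : ι → Matrix (Fin m) (Fin p) ℂ → Matrix (Fin m) (Fin p) ℂ) :
    realDiv (fun v : Matrix (Fin m) (Fin p) ℂ => ∑ i ∈ s, T i v) = ∑ i ∈ s, realDiv (T i) := by
  classical
  induction s using Finset.induction_on with
  | empty => simp [realDiv]
  | insert i s hi ih =>
    simp only [Finset.sum_insert hi]
    rw [realDiv_add, ih]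

/-- The map is complex linear with complex trace `A.trace * B.trace`, and the real trace of a
complex linear map is twice the real part of its complex trace. -/
lemma realDiv_mul_mul (A : Matrix (Fin m) (Fin m) ℂ) (B : Matrix (Fin p) (Fin p) ℂ) :
    realDiv (fun v : Matrix (Fin m) (Fin p) ℂ => A * v * B) = 2 * (A.trace * B.trace).re := by
  have h : ∀ (a : Fin m) (b : Fin p) (x : ℂ), (A * Matrix.single a b x * B) a b =
      A a a * x * B b b := by
    intro a b x
    rw [Matrix.mul_apply, Finset.sum_eq_single b]
    · rw [Matrix.mul_single_apply_same]
    · intro k _ hk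
      rw [Matrix.mul_single_apply_of_ne _ _ _ _ _ hk, zero_mul]
    · simp
  have h2 : ∀ a b, ((A * Matrix.single a b (1 : ℂ) * B) a b).re +
      ((A * Matrix.single a b Complex.I * B) a b).im = 2 * (A a a * B b b).re := by
    intro a b
    rw [h, h, mul_one, mul_right_comm]
    simp
    ring
  simp_rw [realDiv, h2, ← Finset.mul_sum]
  congr 1
  rw [Matrix.trace, Matrix.trace, Finset.sum_mul_sum, Complex.re_sum]
  simp only [Complex.re_sum, Matrix.diag_apply]

/-- A conjugate-linear map has real trace zero: the directions `1` and `I` cancel in each entry. -/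
lemma realDiv_mul_conjTranspose_mul (A B : Matrix (Fin m) (Fin p) ℂ) :
    realDiv (fun v : Matrix (Fin m) (Fin p) ℂ => A * vᴴ * B) = 0 := by
  have h : ∀ (a : Fin m) (b : Fin p) (x : ℂ), (A * (Matrix.single a b x)ᴴ * B) a b =
      A a b * star x * B a b := by
    intro a b x
    rw [Matrix.conjTranspose_single, Matrix.mul_apply, Finset.sum_eq_single a]
    · rw [Matrix.mul_single_apply_same]
    · intro k _ hk
      rw [Matrix.mul_single_apply_of_ne _ _ _ _ _ hk, zero_mul]
    · simp
  unfold realDiv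
  simp_rw [h]
  simp

/-- The trace of a rank-one map. It turns the term from differentiating the cutoff into the
derivative of the cutoff along the field itself. -/
lemma realDiv_linear_smul (L : Matrix (Fin m) (Fin p) ℂ →ₗ[ℝ] ℝ) (g : Matrix (Fin m) (Fin p) ℂ) :
    realDiv (fun v : Matrix (Fin m) (Fin p) ℂ => (L v : ℂ) • g) = L g := by
  have hg : g = ∑ a, ∑ b, ((g a b).re • Matrix.single a b (1 : ℂ) +
      (g a b).im • Matrix.single a b Complex.I) := by
    conv_lhs => rw [Matrix.matrix_eq_sum_single g]
    refine Finset.sum_congr rfl fun a _ => Finset.sum_congr rfl fun b _ => ?_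
    rw [Matrix.smul_single, Matrix.smul_single, ← Matrix.single_add]
    congr 1
    simp [Complex.re_add_im]
  conv_rhs => rw [hg]
  simp only [realDiv, map_sum, map_add, map_smul, Matrix.smul_apply, smul_eq_mul,
    Complex.re_ofReal_mul, Complex.im_ofReal_mul]
  exact Finset.sum_congr rfl fun a _ => Finset.sum_congr rfl fun b _ => by ring

lemma trace_specFun {U : Matrix (Fin p) (Fin p) ℂ} (hU : U ∈ Matrix.unitaryGroup (Fin p) ℂ)
    (c ℓ : Fin p → ℝ) : (specFun c U ℓ).trace = ((∑ k, -c k / ℓ k : ℝ) : ℂ) := by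
  simp [specFun, Matrix.trace_sum, Matrix.trace_smul, trace_specProj hU]

lemma conjTranspose_specFun (c : Fin p → ℝ) (U : Matrix (Fin p) (Fin p) ℂ) (ℓ : Fin p → ℝ) :
    (specFun c U ℓ)ᴴ = specFun c U ℓ := by
  simp only [specFun, Matrix.conjTranspose_sum, Matrix.conjTranspose_smul, conjTranspose_specProj,
    Complex.star_def, Complex.conj_ofReal]

lemma specProj_mul_specFun {U : Matrix (Fin p) (Fin p) ℂ}
    (hU : U ∈ Matrix.unitaryGroup (Fin p) ℂ) (c ℓ : Fin p → ℝ) (k : Fin p) :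
    specProj U k * specFun c U ℓ = ((-c k / ℓ k : ℝ) : ℂ) • specProj U k := by
  simp [specFun, Finset.mul_sum, specProj_mul_specProj hU]

lemma specFun_mul_specProj {U : Matrix (Fin p) (Fin p) ℂ}
    (hU : U ∈ Matrix.unitaryGroup (Fin p) ℂ) (c ℓ : Fin p → ℝ) (k : Fin p) :
    specFun c U ℓ * specProj U k = ((-c k / ℓ k : ℝ) : ℂ) • specProj U k := by
  simp [specFun, Finset.sum_mul, specProj_mul_specProj hU]

variable {z : Matrix (Fin m) (Fin p) ℂ} {U : Matrix (Fin p) (Fin p) ℂ} {ℓ : Fin p → ℝ}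

/-- The `vᴴ` half of `gramDeriv` is conjugate linear and drops out. In the other half the traces are
`ℓ j` for `z * specProj U j * zᴴ` and `1` for `specProj U k`. -/
lemma realDiv_mul_specFunDeriv (h : IsOrderedSpectralDecomposition (zᴴ * z) U ℓ)
    (c : Fin p → ℝ) :
    realDiv (fun v : Matrix (Fin m) (Fin p) ℂ => z * specFunDeriv c U ℓ z v) =
      2 * ∑ j, ∑ k, mixedDivDiff c ℓ ℓ j k * ℓ j := by
  have h1 : (fun v : Matrix (Fin m) (Fin p) ℂ => z * specFunDeriv c U ℓ z v) = fun v => ∑ j, ∑ k,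
      (mixedDivDiff c ℓ ℓ j k : ℂ) • ((z * specProj U j) * vᴴ * (z * specProj U k) +
        (z * specProj U j * zᴴ) * v * specProj U k) := by
    funext v
    simp only [specFunDeriv, gramDeriv, Matrix.mul_sum, Matrix.mul_smul, Matrix.mul_add,
      Matrix.add_mul, Matrix.mul_assoc]
  have h2 : ∀ j, ((z * specProj U j * zᴴ).trace) = ℓ j := by
    intro j
    rw [Matrix.mul_assoc, Matrix.trace_mul_comm, Matrix.mul_assoc, h.specProj_mul_self,
      Matrix.trace_smul, trace_specProj h.unitary, smul_eq_mul, mul_one]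
  rw [h1, realDiv_sum, Finset.mul_sum]
  refine Finset.sum_congr rfl fun j _ => ?_
  rw [realDiv_sum, Finset.mul_sum]
  refine Finset.sum_congr rfl fun k _ => ?_
  rw [realDiv_smul, realDiv_add, realDiv_mul_conjTranspose_mul, realDiv_mul_mul, h2,
    trace_specProj h.unitary, mul_one, Complex.ofReal_re]
  ring

/-- Along the shrinkage field `zᴴ * z` moves at rate `-2 U Diag(c) U^*`, because the weight `1 / ℓ
k` cancels the eigenvalue. The velocity does not depend on `ℓ`, so `fderiv_cutoff_neg_le` applies.
-/
lemma eigenvalueDeriv_mul_specFun (h : IsOrderedSpectralDecomposition (zᴴ * z) U ℓ)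
    (hℓ : ∀ k, ℓ k ≠ 0) (c : Fin p → ℝ) :
    eigenvalueDeriv U z (z * specFun c U ℓ) = (2 : ℝ) • -c := by
  funext k
  have h1 : (specProj U k * gramDeriv z (z * specFun c U ℓ)).trace =
      ((2 * -c k : ℝ) : ℂ) := by
    have e : gramDeriv z (z * specFun c U ℓ) =
        specFun c U ℓ * (zᴴ * z) + zᴴ * z * specFun c U ℓ := by
      rw [gramDeriv, Matrix.conjTranspose_mul, conjTranspose_specFun, Matrix.mul_assoc _ zᴴ z,
        ← Matrix.mul_assoc zᴴ z]
    rw [e, Matrix.mul_add, ← Matrix.mul_assoc _ (specFun c U ℓ),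
      ← Matrix.mul_assoc _ (zᴴ * z) (specFun c U ℓ), specProj_mul_specFun h.unitary,
      h.specProj_mul_self, Matrix.smul_mul, Matrix.smul_mul, h.specProj_mul_self,
      specProj_mul_specFun h.unitary]
    simp only [Matrix.trace_add, Matrix.trace_smul, trace_specProj h.unitary, smul_eq_mul, mul_one]
    norm_cast
    have := hℓ k
    field_simp
    ring
  rw [eigenvalueDeriv, h1, Complex.ofReal_re]
  simp

/-- The derivative of the eigenvalues as a linear map. -/
def eigenvalueDerivLinear (U : Matrix (Fin p) (Fin p) ℂ) (z : Matrix (Fin m) (Fin p) ℂ) :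
    Matrix (Fin m) (Fin p) ℂ →ₗ[ℝ] Fin p → ℝ where
  toFun := eigenvalueDeriv U z
  map_add' v w := by
    funext k
    simp only [eigenvalueDeriv, gramDeriv, Matrix.conjTranspose_add, Matrix.add_mul, Matrix.mul_add,
      Matrix.trace_add, Complex.add_re, Pi.add_apply]
    ring
  map_smul' x v := by
    funext k
    simp only [eigenvalueDeriv, gramDeriv, Matrix.conjTranspose_smul, Matrix.smul_mul,
      Matrix.mul_smul, Matrix.trace_add, Matrix.trace_smul, star_trivial,
      Complex.add_re, Complex.smul_re, Pi.smul_apply, smul_eq_mul, RingHom.id_apply, mul_add]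

lemma sqNorm_mul_specFun (h : IsOrderedSpectralDecomposition (zᴴ * z) U ℓ)
    (hℓ : ∀ k, ℓ k ≠ 0) (c : Fin p → ℝ) :
    sqNorm (z * specFun c U ℓ) = ∑ k, c k ^ 2 / ℓ k := by
  have h1 : (z * specFun c U ℓ)ᴴ * (z * specFun c U ℓ) =
      ∑ k, ((c k ^ 2 / ℓ k : ℝ) : ℂ) • specProj U k := by
    rw [Matrix.conjTranspose_mul, conjTranspose_specFun, Matrix.mul_assoc, ← Matrix.mul_assoc zᴴ]
    conv_lhs => enter [2, 2]; rw [specFun]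
    rw [Finset.mul_sum, Finset.mul_sum]
    refine Finset.sum_congr rfl fun k _ => ?_
    rw [Matrix.mul_smul, h.self_mul_specProj, Matrix.mul_smul, Matrix.mul_smul,
      specFun_mul_specProj h.unitary, smul_smul, smul_smul]
    congr 1
    norm_cast
    have := hℓ k
    field_simp
  rw [sqNorm_eq_trace, h1, Matrix.trace_sum]
  simp only [Matrix.trace_smul, trace_specProj h.unitary, smul_eq_mul, mul_one, Complex.re_sum,
    Complex.ofReal_re]

lemma sqNorm_smul (x : ℝ) (A : Matrix (Fin m) (Fin p) ℂ) :
    sqNorm ((x : ℂ) • A) = x ^ 2 * sqNorm A := by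
  unfold sqNorm
  simp only [Matrix.smul_apply, norm_smul, mul_pow, Complex.norm_real, Real.norm_eq_abs, sq_abs,
    Finset.mul_sum]

end Divergence

/-! ### The scalar inequality behind the choice of weights. -/

section WeightInequality

variable {p : ℕ}

lemma sum_two_mul_sub (j : Fin p) :
    ∑ k : Fin p, (if j < k then 2 * ((k : ℝ) - j) else 0) =
      ((p : ℝ) - 1 - j) * ((p : ℝ) - j) := by
  have h : ∀ a n : ℕ, a + 1 ≤ n → ∑ k ∈ Finset.range n, (if a < k then 2 * ((k : ℝ) - a) else 0) =
      ((n : ℝ) - 1 - a) * ((n : ℝ) - a) := by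
    intro a n hn
    induction n, hn using Nat.le_induction with
    | base =>
      rw [Finset.sum_eq_zero fun k hk => if_neg (by have := Finset.mem_range.1 hk; omega)]
      push_cast
      ring
    | succ n hn ih =>
      rw [Finset.sum_range_succ, ih, if_pos (by omega)]
      push_cast
      ring
  rw [← h j p j.2, ← Fin.sum_univ_eq_sum_range
    (fun k => if (j : ℕ) < k then 2 * ((k : ℝ) - (j : ℕ)) else 0)]
  rfl

lemma mixedDivDiff_mul_eq {c l : Fin p → ℝ} (hl : IsSimplePos l) (j k : Fin p) :
    mixedDivDiff c l l j k * l j = c k / l k - (c j - c k) / (l j - l k) := by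
  have hj := (hl.2 j).ne'
  have hk := (hl.2 k).ne'
  unfold mixedDivDiff
  split_ifs with h
  · subst h
    rw [sub_self, zero_div, sub_zero]
    field_simp
  · have h1 : l k - l j ≠ 0 := sub_ne_zero.2 (hl.ne h).symm
    have h2 : l j - l k ≠ 0 := sub_ne_zero.2 (hl.ne h)
    rw [← neg_sub (l k) (l j), div_neg, sub_neg_eq_add]
    field_simp
    ring

/-- This says that the unbiased estimate of the risk change is negative. The increments `c j - c k =
2 (k - j)` make the repulsion terms `(c j - c k) / (l j - l k)` strong enough to outweigh the
quadratic term. -/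
lemma weight_inequality (m : ℕ) (hp : 1 ≤ p) (hmp : p < m) {c l : Fin p → ℝ} (hl : IsSimplePos l)
    (hc : ∀ k : Fin p, c k = m + p - 2 * ((k : ℕ) + 1)) :
    ∑ k, c k ^ 2 / l k + 2 * (m * ∑ k, -c k / l k + ∑ j, ∑ k, mixedDivDiff c l l j k * l j) ≤
      -(1 / (1 + ∑ k, l k)) := by
  have hmp' : (p : ℝ) + 1 ≤ m := by exact_mod_cast hmp
  set a : Fin p → Fin p → ℝ := fun j k => if j < k then 2 * ((k : ℝ) - j) / l j else 0 with ha
  have hq : ∀ j k, a j k + a k j ≤ (c j - c k) / (l j - l k) := by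
    have key : ∀ j k : Fin p, j < k → a j k + a k j ≤ (c j - c k) / (l j - l k) := by
      intro j k hjk
      simp only [ha, if_pos hjk, if_neg hjk.asymm, add_zero]
      have e : c j - c k = 2 * ((k : ℝ) - j) := by rw [hc, hc]; ring
      have hjk' : (j : ℝ) ≤ k := by exact_mod_cast hjk.le
      rw [e]
      -- Since `l k > 0`, replacing `l j - l k` by the larger `l j` only decreases the quotient, and
      -- separates the variables.
      exact div_le_div_of_nonneg_left (by linarith) (sub_pos.2 (hl.1 hjk))
        (by linarith [hl.2 k])
    intro j k
    rcases lt_trichotomy j k with h | h | h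
    · exact key j k h
    · subst h; simp [ha]
    · have := key k j h
      rw [← neg_sub (c k), ← neg_sub (l k), neg_div_neg_eq, add_comm]
      exact this
  have hsum : ∀ j, ∑ k, a j k = ((p : ℝ) - 1 - j) * ((p : ℝ) - j) / l j := by
    intro j
    rw [← sum_two_mul_sub j, Finset.sum_div]
    refine Finset.sum_congr rfl fun k _ => ?_
    simp only [ha]
    split_ifs <;> simp
  have h1 : 2 * ∑ j : Fin p, ((p : ℝ) - 1 - j) * ((p : ℝ) - j) / l j ≤
      ∑ j, ∑ k, (c j - c k) / (l j - l k) := by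
    have e : ∑ j, ∑ k, (a j k + a k j) = 2 * ∑ j : Fin p, ((p : ℝ) - 1 - j) * ((p : ℝ) - j) / l j := by
      simp only [Finset.sum_add_distrib]
      rw [Finset.sum_comm (f := fun j k => a k j)]
      simp_rw [hsum]
      ring
    rw [← e]
    exact Finset.sum_le_sum fun j _ => Finset.sum_le_sum fun k _ => hq j k
  have h2 : ∑ j, ∑ k, mixedDivDiff c l l j k * l j =
      p * ∑ k, c k / l k - ∑ j, ∑ k, (c j - c k) / (l j - l k) := by
    simp_rw [mixedDivDiff_mul_eq hl, Finset.sum_sub_distrib]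
    simp
  have h3 : ∑ k : Fin p, (c k ^ 2 / l k - 2 * m * (c k / l k) + 2 * p * (c k / l k) -
      4 * (((p : ℝ) - 1 - k) * ((p : ℝ) - k) / l k)) ≤ ∑ k : Fin p, -(1 / l k) := by
    refine Finset.sum_le_sum fun k _ => ?_
    have hk : ((k : ℕ) : ℝ) + 1 ≤ p := by exact_mod_cast k.2
    -- With `d = m - p` and `q = p - 1 - k` one has `c k = d + 2q`, and `c² - 2dc - 4q(q + 1) = -(d²
    -- + 4q)`. Here `d ≥ 1` and `q ≥ 0`, so the numerator is at most `-1`.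
    have e : c k ^ 2 / l k - 2 * m * (c k / l k) + 2 * p * (c k / l k) -
        4 * (((p : ℝ) - 1 - k) * ((p : ℝ) - k) / l k) =
        (-(((m : ℝ) - p) ^ 2 + 4 * (p - 1 - k))) / l k := by
      have := (hl.2 k).ne'
      rw [hc]
      field_simp
      ring
    rw [e, ← neg_div]
    refine div_le_div_of_nonneg_right ?_ (hl.2 k).le
    nlinarith
  -- The gain is weakened to a function of the trace that is continuous and bounded also at singular
  -- matrices.
  have h4 : ∑ k : Fin p, -(1 / l k) ≤ -(1 / (1 + ∑ k, l k)) := by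
    rw [Finset.sum_neg_distrib, neg_le_neg_iff]
    let k₀ : Fin p := ⟨0, hp⟩
    calc 1 / (1 + ∑ k, l k) ≤ 1 / l k₀ := by
          refine one_div_le_one_div_of_le (hl.2 k₀) ?_
          linarith [Finset.single_le_sum (fun k _ => (hl.2 k).le) (Finset.mem_univ k₀)]
      _ ≤ ∑ k, 1 / l k := Finset.single_le_sum (f := fun k => 1 / l k)
          (fun k _ => (one_div_pos.2 (hl.2 k)).le) (Finset.mem_univ k₀)
  refine le_trans (le_trans ?_ h3) h4
  simp only [Finset.sum_sub_distrib, Finset.sum_add_distrib, ← Finset.mul_sum]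
  rw [h2]
  simp only [neg_div, Finset.sum_neg_distrib]
  linarith

end WeightInequality

/-! ### Pointwise bound on the risk estimate of the truncated field. -/

section FieldInequality

variable {m p : ℕ} {U : Matrix (Fin m) (Fin p) ℂ → Matrix (Fin p) (Fin p) ℂ}
  {ℓ : Matrix (Fin m) (Fin p) ℂ → Fin p → ℝ}

lemma realDiv_shrinkFieldDeriv {z : Matrix (Fin m) (Fin p) ℂ}
    (h : IsOrderedSpectralDecomposition (zᴴ * z) (U z) (ℓ z)) (hℓ : ∀ k, ℓ z k ≠ 0) (r : ℝ)
    (c : Fin p → ℝ) :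
    realDiv (fun v : Matrix (Fin m) (Fin p) ℂ => shrinkFieldDeriv r c U ℓ v z) =
      cutoff r (ℓ z) * (2 * (m * ∑ k, -c k / ℓ z k +
        ∑ j, ∑ k, mixedDivDiff c (ℓ z) (ℓ z) j k * ℓ z j)) +
      2 * fderiv ℝ (cutoff r) (ℓ z) (-c) := by
  unfold shrinkFieldDeriv
  rw [realDiv_add, realDiv_smul, realDiv_add, realDiv_mul_specFunDeriv h]
  have h1 := realDiv_mul_mul (1 : Matrix (Fin m) (Fin m) ℂ) (specFun c (U z) (ℓ z))
  simp only [Matrix.one_mul, Matrix.trace_one, Fintype.card_fin] at h1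
  rw [h1, trace_specFun h.unitary]
  have h2 := realDiv_linear_smul ((fderiv ℝ (cutoff r) (ℓ z)).toLinearMap ∘ₗ
    eigenvalueDerivLinear (U z) z) (z * specFun c (U z) (ℓ z))
  have h3 : ((fderiv ℝ (cutoff r) (ℓ z)).toLinearMap ∘ₗ eigenvalueDerivLinear (U z) z)
      (z * specFun c (U z) (ℓ z)) = 2 * fderiv ℝ (cutoff r) (ℓ z) (-c) := by
    change fderiv ℝ (cutoff r) (ℓ z) (eigenvalueDeriv (U z) z _) = _
    rw [eigenvalueDeriv_mul_specFun h hℓ, map_smul, smul_eq_mul]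
  rw [h3] at h2
  have h4 : realDiv (fun v : Matrix (Fin m) (Fin p) ℂ => (fderiv ℝ (cutoff r) (ℓ z) (eigenvalueDeriv (U z) z v) : ℂ) •
      (z * specFun c (U z) (ℓ z))) = 2 * fderiv ℝ (cutoff r) (ℓ z) (-c) := h2
  rw [h4]
  congr 2
  rw [mul_add]
  congr 2
  norm_cast

/-- Since `0 ≤ cutoff ≤ 1`, the square of the cutoff in front of the squared norm may be replaced by
the cutoff. The whole is then the cutoff times `weight_inequality`, plus twice the directional
derivative bounded by `fderiv_cutoff_neg_le`. -/
lemma sqNorm_shrinkField_add_realDiv_le (hp : 1 ≤ p) (hmp : p < m)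
    (hUℓ : ∀ z : Matrix (Fin m) (Fin p) ℂ, IsOrderedSpectralDecomposition (zᴴ * z) (U z) (ℓ z))
    {r : ℝ} (hr : 0 < r) {c : Fin p → ℝ} (hc : ∀ k : Fin p, c k = m + p - 2 * ((k : ℕ) + 1))
    (z : Matrix (Fin m) (Fin p) ℂ) :
    sqNorm (shrinkField r c U ℓ z) + realDiv (fun v : Matrix (Fin m) (Fin p) ℂ => shrinkFieldDeriv r c U ℓ v z) +
      cutoff r (ℓ z) * (1 / (1 + sqNorm z)) ≤ 4 * (∑ k, c k) / r := by
  have hmp' : (p : ℝ) + 1 ≤ m := by exact_mod_cast hmp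
  have hc0 : ∀ k, 0 ≤ c k := fun k => by
    have hk : ((k : ℕ) : ℝ) + 1 ≤ p := by exact_mod_cast k.2
    rw [hc]; linarith
  have hca : Antitone c := fun j k hjk => by
    have : (j : ℝ) ≤ k := by exact_mod_cast hjk
    rw [hc, hc]; linarith
  have hS : 0 ≤ 4 * (∑ k, c k) / r :=
    div_nonneg (mul_nonneg (by norm_num) (Finset.sum_nonneg fun k _ => hc0 k)) hr.le
  by_cases hz : IsSimplePos (ℓ z)
  · have hne : ∀ k, ℓ z k ≠ 0 := fun k => (hz.2 k).ne'
    rw [realDiv_shrinkFieldDeriv (hUℓ z) hne, shrinkField, sqNorm_smul,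
      sqNorm_mul_specFun (hUℓ z) hne]
    have h1 := weight_inequality m hp hmp hz hc
    have h2 := fderiv_cutoff_neg_le hr hca hc0 (ℓ z)
    have h3 := cutoff_nonneg r (ℓ z)
    have h4 := cutoff_le_one r (ℓ z)
    rw [sum_eigenvalue (hUℓ z)] at h1
    have h5 : 0 ≤ ∑ k, c k ^ 2 / ℓ z k :=
      Finset.sum_nonneg fun k _ => div_nonneg (sq_nonneg _) (hz.2 k).le
    have h6 : cutoff r (ℓ z) ^ 2 * ∑ k, c k ^ 2 / ℓ z k ≤
        cutoff r (ℓ z) * ∑ k, c k ^ 2 / ℓ z k :=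
      mul_le_mul_of_nonneg_right (by nlinarith) h5
    have h7 := mul_le_mul_of_nonneg_left h1 h3
    have h8 : 4 * (∑ k, c k) / r = 2 * (2 * (∑ k, c k) / r) := by ring
    rw [h8]
    nlinarith
  · have h1 := (eventually_cutoff_eq_zero r hr hz).self_of_nhds
    have h2 := (eventually_fderiv_cutoff_eq_zero hr hz).self_of_nhds
    have h3 : sqNorm (shrinkField r c U ℓ z) = 0 := by
      rw [shrinkField, sqNorm_smul, h1]; simp
    have h4 : realDiv (fun v : Matrix (Fin m) (Fin p) ℂ => shrinkFieldDeriv r c U ℓ v z) = 0 := by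
      simp [realDiv, shrinkFieldDeriv, h1, h2]
    rw [h3, h4, h1]
    simpa using hS

end FieldInequality

/-! ### Stein's identity and the unbiased risk estimate. -/

section Stein

open Filter Topology

variable {m p : ℕ}

/-- The real inner product on complex matrices. -/
def frobInner (z w : Fin m → Fin p → ℂ) : ℝ :=
  ∑ i, ∑ j, ((z i j).re * (w i j).re + (z i j).im * (w i j).im)

lemma continuous_frobInner_left (w : Fin m → Fin p → ℂ) :
    Continuous fun z : Fin m → Fin p → ℂ => frobInner z w := by
  unfold frobInner; fun_prop

lemma sqNorm_add (z w : Fin m → Fin p → ℂ) :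
    sqNorm (z + w) = sqNorm z + 2 * frobInner z w + sqNorm w := by
  simp only [sqNorm, frobInner, Finset.mul_sum, ← Finset.sum_add_distrib]
  refine Finset.sum_congr rfl fun i _ => Finset.sum_congr rfl fun j _ => ?_
  simp only [← Complex.normSq_eq_norm_sq, Complex.normSq_apply, Pi.add_apply, Complex.add_re,
    Complex.add_im]
  ring

lemma hasLineDerivAt_matrixGaussianPDF (Ξ v z : Fin m → Fin p → ℂ) :
    HasLineDerivAt ℝ (matrixGaussianPDF 1 Ξ)
      (-(2 * frobInner (z - Ξ) v * matrixGaussianPDF 1 Ξ z)) z v := by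
  have h1 : HasDerivAt (fun t : ℝ => sqNorm (z + t • v - Ξ)) (2 * frobInner (z - Ξ) v) 0 := by
    have e : (fun t : ℝ => sqNorm (z + t • v - Ξ)) =
        fun t => t * (2 * frobInner (z - Ξ) v) + t ^ 2 * sqNorm v + sqNorm (z - Ξ) := by
      funext t
      have e1 : z + t • v - Ξ = (z - Ξ) + t • v := by abel
      have e2 : frobInner (z - Ξ) (t • v) = t * frobInner (z - Ξ) v := by
        simp only [frobInner, Finset.mul_sum, Pi.smul_apply, Complex.smul_re, Complex.smul_im,
          smul_eq_mul]
        exact Finset.sum_congr rfl fun i _ => Finset.sum_congr rfl fun j _ => by ring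
      have e3 : sqNorm (t • v) = t ^ 2 * sqNorm v := by
        simp only [sqNorm, Finset.mul_sum, Pi.smul_apply, norm_smul, mul_pow, Real.norm_eq_abs,
          sq_abs]
      rw [e1, sqNorm_add, e2, e3]
      ring
    rw [e]
    have h2 := (hasDerivAt_id (0 : ℝ)).mul_const (2 * frobInner (z - Ξ) v)
    have h3 := ((hasDerivAt_id (0 : ℝ)).pow 2).mul_const (sqNorm v)
    simpa using (h2.add h3).add_const (sqNorm (z - Ξ))
  have h2 := ((h1.neg.div_const 1).exp).const_mul ((Real.pi * 1)⁻¹ ^ (m * p))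
  simp only [HasLineDerivAt, matrixGaussianPDF_eq]
  refine h2.congr_deriv ?_
  simp
  ring

lemma integrable_of_eq_zero_of_lt {f : (Fin m → Fin p → ℂ) → ℝ} (hf : Continuous f) {r : ℝ}
    (h : ∀ z, r < ‖z‖ → f z = 0) : Integrable f := by
  refine hf.integrable_of_hasCompactSupport (HasCompactSupport.intro
    (isCompact_closedBall (0 : Fin m → Fin p → ℂ) r) fun z hz => h z ?_)
  simpa using hz

/-- Gaussian integration by parts in one direction. -/
lemma integral_matrixGaussianPDF_mul_lineDeriv (Ξ v : Fin m → Fin p → ℂ)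
    {u u' : (Fin m → Fin p → ℂ) → ℝ} (hu : Continuous u) (hu' : Continuous u') {r : ℝ}
    (h0 : ∀ z, r < ‖z‖ → u z = 0) (h0' : ∀ z, r < ‖z‖ → u' z = 0)
    (hd : ∀ z, HasLineDerivAt ℝ u (u' z) z v) :
    ∫ z, matrixGaussianPDF 1 Ξ z * u' z =
      ∫ z, matrixGaussianPDF 1 Ξ z * (2 * frobInner (z - Ξ) v * u z) := by
  have hφ := continuous_matrixGaussianPDF 1 Ξ
  have hφ' : Continuous fun z => -(2 * frobInner (z - Ξ) v * matrixGaussianPDF 1 Ξ z) :=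
    ((continuous_const.mul ((continuous_frobInner_left v).comp (by fun_prop))).mul hφ).neg
  have h := integral_bilinear_hasLineDerivAt_right_eq_neg_left_of_integrable
    (μ := (volume : Measure (Fin m → Fin p → ℂ))) (f := matrixGaussianPDF 1 Ξ)
    (f' := fun z => -(2 * frobInner (z - Ξ) v * matrixGaussianPDF 1 Ξ z)) (g := u) (g' := u')
    (v := v) (B := ContinuousLinearMap.mul ℝ ℝ)
    (integrable_of_eq_zero_of_lt (r := r) (hφ'.mul hu) fun z hz => by simp [h0 z hz])
    (integrable_of_eq_zero_of_lt (r := r) (hφ.mul hu') fun z hz => by simp [h0' z hz])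
    (integrable_of_eq_zero_of_lt (r := r) (hφ.mul hu) fun z hz => by simp [h0 z hz])
    (fun z _ => hasLineDerivAt_matrixGaussianPDF Ξ v z) fun z _ => hd z
  simp only [ContinuousLinearMap.mul_apply'] at h
  rw [h, ← integral_neg]
  refine integral_congr_ae (.of_forall fun z => ?_)
  simp only
  ring

lemma frobInner_single_one (w : Fin m → Fin p → ℂ) (i : Fin m) (j : Fin p) :
    frobInner w (Matrix.single i j (1 : ℂ)) = (w i j).re := by
  unfold frobInner
  rw [Finset.sum_eq_single i, Finset.sum_eq_single j]
  · simp
  · intro b _ hb; simp [hb.symm]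
  · simp
  · intro a _ ha; simp [ha.symm]
  · simp

lemma frobInner_single_I (w : Fin m → Fin p → ℂ) (i : Fin m) (j : Fin p) :
    frobInner w (Matrix.single i j Complex.I) = (w i j).im := by
  unfold frobInner
  rw [Finset.sum_eq_single i, Finset.sum_eq_single j]
  · simp
  · intro b _ hb; simp [hb.symm]
  · simp
  · intro a _ ha; simp [ha.symm]
  · simp

/-- Stein's identity for compactly supported vector fields. -/
lemma integral_frobInner_eq_integral_realDiv (Ξ : Fin m → Fin p → ℂ)
    {G : (Fin m → Fin p → ℂ) → Fin m → Fin p → ℂ}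
    {G' : (Fin m → Fin p → ℂ) → (Fin m → Fin p → ℂ) → Fin m → Fin p → ℂ}
    (hG : Continuous G) (hG' : ∀ v, Continuous (G' v)) {r : ℝ}
    (h0 : ∀ z, r < ‖z‖ → G z = 0) (h0' : ∀ v z, r < ‖z‖ → G' v z = 0)
    (hd : ∀ v z i j, HasDerivAt (fun t : ℝ => G (z + t • v) i j) (G' v z i j) 0) :
    ∫ z : Fin m → Fin p → ℂ, matrixGaussianPDF 1 Ξ z * (2 * frobInner (z - Ξ) (G z)) =
      ∫ z : Fin m → Fin p → ℂ, matrixGaussianPDF 1 Ξ z * realDiv fun v => G' v z := by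
  have hφ := continuous_matrixGaussianPDF 1 Ξ
  have hre : ∀ i j, Continuous fun z : Fin m → Fin p → ℂ => (G z i j).re := fun i j =>
    Complex.continuous_re.comp (continuous_pi_iff.1 (continuous_pi_iff.1 hG i) j)
  have him : ∀ i j, Continuous fun z : Fin m → Fin p → ℂ => (G z i j).im := fun i j =>
    Complex.continuous_im.comp (continuous_pi_iff.1 (continuous_pi_iff.1 hG i) j)
  have hre' : ∀ v i j, Continuous fun z : Fin m → Fin p → ℂ => (G' v z i j).re := fun v i j =>
    Complex.continuous_re.comp (continuous_pi_iff.1 (continuous_pi_iff.1 (hG' v) i) j)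
  have him' : ∀ v i j, Continuous fun z : Fin m → Fin p → ℂ => (G' v z i j).im := fun v i j =>
    Complex.continuous_im.comp (continuous_pi_iff.1 (continuous_pi_iff.1 (hG' v) i) j)
  have hre0 : ∀ v i j z, r < ‖z‖ → (G' v z i j).re = 0 := fun v i j z hz => by simp [h0' v z hz]
  have him0 : ∀ v i j z, r < ‖z‖ → (G' v z i j).im = 0 := fun v i j z hz => by simp [h0' v z hz]
  have k1 : ∀ i j, ∫ z : Fin m → Fin p → ℂ,
      matrixGaussianPDF 1 Ξ z * (G' (Matrix.single i j 1) z i j).re =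
      ∫ z : Fin m → Fin p → ℂ, matrixGaussianPDF 1 Ξ z * (2 * (z i j - Ξ i j).re * (G z i j).re) := by
    intro i j
    rw [integral_matrixGaussianPDF_mul_lineDeriv Ξ (Matrix.single i j (1 : ℂ)) (hre i j)
      (hre' (Matrix.single i j 1) i j) (r := r) (fun z hz => by simp [h0 z hz])
      (fun z hz => hre0 _ i j z hz)
      (fun z => (Complex.reCLM.hasFDerivAt.comp_hasDerivAt (0 : ℝ)
        (hd (Matrix.single i j (1 : ℂ)) z i j)))]
    simp only [frobInner_single_one, Pi.sub_apply]
  have k2 : ∀ i j, ∫ z : Fin m → Fin p → ℂ,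
      matrixGaussianPDF 1 Ξ z * (G' (Matrix.single i j Complex.I) z i j).im =
      ∫ z : Fin m → Fin p → ℂ, matrixGaussianPDF 1 Ξ z * (2 * (z i j - Ξ i j).im * (G z i j).im) := by
    intro i j
    rw [integral_matrixGaussianPDF_mul_lineDeriv Ξ (Matrix.single i j Complex.I) (him i j)
      (him' (Matrix.single i j Complex.I) i j) (r := r) (fun z hz => by simp [h0 z hz])
      (fun z hz => him0 _ i j z hz)
      (fun z => (Complex.imCLM.hasFDerivAt.comp_hasDerivAt (0 : ℝ)
        (hd (Matrix.single i j Complex.I) z i j)))]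
    simp only [frobInner_single_I, Pi.sub_apply]
  have i1 : ∀ i j, Integrable fun z : Fin m → Fin p → ℂ =>
      matrixGaussianPDF 1 Ξ z * (2 * (z i j - Ξ i j).re * (G z i j).re) := fun i j =>
    integrable_of_eq_zero_of_lt (r := r) (hφ.mul (((by fun_prop : Continuous
      fun z : Fin m → Fin p → ℂ => 2 * (z i j - Ξ i j).re)).mul (hre i j)))
      fun z hz => by simp [h0 z hz]
  have i2 : ∀ i j, Integrable fun z : Fin m → Fin p → ℂ =>
      matrixGaussianPDF 1 Ξ z * (2 * (z i j - Ξ i j).im * (G z i j).im) := fun i j =>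
    integrable_of_eq_zero_of_lt (r := r) (hφ.mul (((by fun_prop : Continuous
      fun z : Fin m → Fin p → ℂ => 2 * (z i j - Ξ i j).im)).mul (him i j)))
      fun z hz => by simp [h0 z hz]
  have i3 : ∀ i j, Integrable fun z : Fin m → Fin p → ℂ =>
      matrixGaussianPDF 1 Ξ z * (G' (Matrix.single i j 1) z i j).re := fun i j =>
    integrable_of_eq_zero_of_lt (r := r) (hφ.mul (hre' _ i j)) fun z hz =>
      mul_eq_zero_of_right _ (hre0 _ i j z hz)
  have i4 : ∀ i j, Integrable fun z : Fin m → Fin p → ℂ =>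
      matrixGaussianPDF 1 Ξ z * (G' (Matrix.single i j Complex.I) z i j).im := fun i j =>
    integrable_of_eq_zero_of_lt (r := r) (hφ.mul (him' _ i j)) fun z hz =>
      mul_eq_zero_of_right _ (him0 _ i j z hz)
  have e1 : ∀ z : Fin m → Fin p → ℂ, matrixGaussianPDF 1 Ξ z * (2 * frobInner (z - Ξ) (G z)) =
      ∑ i, ∑ j, (matrixGaussianPDF 1 Ξ z * (2 * (z i j - Ξ i j).re * (G z i j).re) +
        matrixGaussianPDF 1 Ξ z * (2 * (z i j - Ξ i j).im * (G z i j).im)) := by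
    intro z
    simp only [frobInner, Finset.mul_sum, Pi.sub_apply]
    exact Finset.sum_congr rfl fun i _ => Finset.sum_congr rfl fun j _ => by ring
  have e2 : ∀ z : Fin m → Fin p → ℂ, (matrixGaussianPDF 1 Ξ z * realDiv fun v => G' v z) =
      ∑ i, ∑ j, (matrixGaussianPDF 1 Ξ z * (G' (Matrix.single i j 1) z i j).re +
        matrixGaussianPDF 1 Ξ z * (G' (Matrix.single i j Complex.I) z i j).im) := by
    intro z
    simp only [realDiv, Finset.mul_sum, mul_add]
  simp_rw [e1, e2]
  have i12 : ∀ i j, Integrable fun z : Fin m → Fin p → ℂ =>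
      matrixGaussianPDF 1 Ξ z * (2 * (z i j - Ξ i j).re * (G z i j).re) +
        matrixGaussianPDF 1 Ξ z * (2 * (z i j - Ξ i j).im * (G z i j).im) := fun i j =>
    (i1 i j).add (i2 i j)
  have i34 : ∀ i j, Integrable fun z : Fin m → Fin p → ℂ =>
      matrixGaussianPDF 1 Ξ z * (G' (Matrix.single i j 1) z i j).re +
        matrixGaussianPDF 1 Ξ z * (G' (Matrix.single i j Complex.I) z i j).im := fun i j =>
    (i3 i j).add (i4 i j)
  rw [integral_finsetSum _ fun i _ => integrable_finsetSum _ fun j _ => i12 i j,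
    integral_finsetSum _ fun i _ => integrable_finsetSum _ fun j _ => i34 i j]
  refine Finset.sum_congr rfl fun i _ => ?_
  rw [integral_finsetSum _ fun j _ => i12 i j, integral_finsetSum _ fun j _ => i34 i j]
  refine Finset.sum_congr rfl fun j _ => ?_
  rw [integral_add (i1 i j) (i2 i j), integral_add (i3 i j) (i4 i j), k1, k2]

lemma integrable_and_integral_eq {f : (Fin m → Fin p → ℂ) → ℝ} (hf : Continuous f)
    (h0 : ∀ z, 0 ≤ f z) {a : ℝ} (ha : 0 ≤ a) (h : ∫⁻ z, ENNReal.ofReal (f z) = ENNReal.ofReal a) :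
    Integrable f ∧ ∫ z, f z = a := by
  constructor
  · refine ⟨hf.aestronglyMeasurable, ?_⟩
    rw [hasFiniteIntegral_iff_ofReal (.of_forall h0), h]
    exact ENNReal.ofReal_lt_top
  · rw [integral_eq_lintegral_of_nonneg_ae (.of_forall h0) hf.aestronglyMeasurable, h,
      ENNReal.toReal_ofReal ha]

lemma lintegral_matrixGaussian_ofReal {f : (Fin m → Fin p → ℂ) → ℝ} (hf : Continuous f)
    (Ξ : Fin m → Fin p → ℂ) : ∫⁻ z, ENNReal.ofReal (f z) ∂matrixGaussian 1 Ξ =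
      ∫⁻ z, ENNReal.ofReal (matrixGaussianPDF 1 Ξ z * f z) := by
  rw [lintegral_matrixGaussian _ hf.measurable.ennreal_ofReal]
  exact lintegral_congr fun z => (ENNReal.ofReal_mul (matrixGaussianPDF_nonneg one_pos _ _)).symm

/-- A bound on the unbiased risk estimate of `z + G z` bounds the risk. -/
lemma lintegral_le_of_unbiased_risk_estimate_le (Ξ : Fin m → Fin p → ℂ)
    {G : (Fin m → Fin p → ℂ) → Fin m → Fin p → ℂ}
    {G' : (Fin m → Fin p → ℂ) → (Fin m → Fin p → ℂ) → Fin m → Fin p → ℂ}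
    {κ : (Fin m → Fin p → ℂ) → ℝ}
    (hG : Continuous G) (hG' : ∀ v, Continuous (G' v)) (hκ : Continuous κ) {r : ℝ}
    (h0 : ∀ z, r < ‖z‖ → G z = 0) (h0' : ∀ v z, r < ‖z‖ → G' v z = 0)
    (hκ0 : ∀ z, r < ‖z‖ → κ z = 0) (hκ1 : ∀ z, 0 ≤ κ z)
    (hd : ∀ v z i j, HasDerivAt (fun t : ℝ => G (z + t • v) i j) (G' v z i j) 0)
    {C : ℝ} (hC : ∀ z, sqNorm (G z) + realDiv (fun v => G' v z) + κ z ≤ C) :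
    ∫⁻ z, ENNReal.ofReal (sqNorm (z - Ξ + G z) + κ z) ∂matrixGaussian 1 Ξ ≤
      ENNReal.ofReal (m * p + C) := by
  have hφ := continuous_matrixGaussianPDF 1 Ξ
  have hφ0 := matrixGaussianPDF_nonneg one_pos Ξ
  have hstein := integral_frobInner_eq_integral_realDiv Ξ hG hG' h0 h0' hd
  have hinner : Continuous fun z : Fin m → Fin p → ℂ => 2 * frobInner (z - Ξ) (G z) := by
    unfold frobInner; fun_prop
  have hsq : Continuous fun z => sqNorm (G z) := continuous_sqNorm.comp hG
  have hdiv : Continuous fun z : Fin m → Fin p → ℂ => realDiv fun v => G' v z :=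
    continuous_finsetSum _ fun a _ => continuous_finsetSum _ fun b _ =>
      (Complex.continuous_re.comp (continuous_pi_iff.1 (continuous_pi_iff.1 (hG' _) a) b)).add
        (Complex.continuous_im.comp (continuous_pi_iff.1 (continuous_pi_iff.1 (hG' _) a) b))
  have hX : Continuous fun z : Fin m → Fin p → ℂ => sqNorm (z - Ξ) :=
    continuous_sqNorm.comp (continuous_id.sub continuous_const)
  obtain ⟨iφ, eφ⟩ := integrable_and_integral_eq hφ hφ0 zero_le_one (by
    have := (isProbabilityMeasure_matrixGaussian one_pos Ξ).measure_univ
    rw [matrixGaussian, withDensity_apply _ .univ, Measure.restrict_univ] at this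
    rw [this, ENNReal.ofReal_one])
  obtain ⟨iX, eX⟩ := integrable_and_integral_eq
    (f := fun z => matrixGaussianPDF 1 Ξ z * sqNorm (z - Ξ)) (hφ.mul hX)
    (fun z => mul_nonneg (hφ0 z) (sqNorm_nonneg _)) (a := m * p) (by positivity) (by
      have := lintegral_sqNorm_matrixGaussian one_pos Ξ
      rw [lintegral_matrixGaussian_ofReal hX, mul_one] at this
      exact this)
  have hre0 : ∀ v i j z, r < ‖z‖ → (G' v z i j).re = 0 := fun v i j z hz => by simp [h0' v z hz]
  have him0 : ∀ v i j z, r < ‖z‖ → (G' v z i j).im = 0 := fun v i j z hz => by simp [h0' v z hz]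
  have z1 : ∀ z, r < ‖z‖ → sqNorm (G z) = 0 := by
    intro z hz
    rw [h0 z hz]
    simp [sqNorm]
  have iI : Integrable fun z : Fin m → Fin p → ℂ => matrixGaussianPDF 1 Ξ z *
      (2 * frobInner (z - Ξ) (G z)) :=
    integrable_of_eq_zero_of_lt (r := r) (hφ.mul hinner) fun z hz => by
      rw [h0 z hz]; simp [frobInner]
  have iS : Integrable fun z : Fin m → Fin p → ℂ => matrixGaussianPDF 1 Ξ z *
      (sqNorm (G z) + κ z) :=
    integrable_of_eq_zero_of_lt (r := r) (hφ.mul (hsq.add hκ)) fun z hz => by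
      rw [z1 z hz, hκ0 z hz]; simp
  have iD : Integrable fun z : Fin m → Fin p → ℂ => matrixGaussianPDF 1 Ξ z *
      realDiv fun v => G' v z :=
    integrable_of_eq_zero_of_lt (r := r) (hφ.mul hdiv) fun z hz =>
      mul_eq_zero_of_right _ (Finset.sum_eq_zero fun a _ => Finset.sum_eq_zero fun b _ =>
        (congrArg₂ (· + ·) (hre0 _ a b z hz) (him0 _ a b z hz)).trans (add_zero 0))
  have hF : Continuous fun z => sqNorm (z - Ξ + G z) + κ z :=
    (continuous_sqNorm.comp ((continuous_id.sub continuous_const).add hG)).add hκ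
  have hF0 : ∀ z, 0 ≤ sqNorm (z - Ξ + G z) + κ z := fun z => add_nonneg (sqNorm_nonneg _) (hκ1 z)
  have eF : ∀ z, matrixGaussianPDF 1 Ξ z * (sqNorm (z - Ξ + G z) + κ z) =
      matrixGaussianPDF 1 Ξ z * sqNorm (z - Ξ) + (matrixGaussianPDF 1 Ξ z *
      (2 * frobInner (z - Ξ) (G z)) + matrixGaussianPDF 1 Ξ z * (sqNorm (G z) + κ z)) := by
    intro z
    rw [sqNorm_add]
    ring
  rw [lintegral_matrixGaussian_ofReal hF]
  simp_rw [eF]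
  have iT := iX.add (iI.add iS)
  have hT0 : 0 ≤ᵐ[volume] fun z => matrixGaussianPDF 1 Ξ z * sqNorm (z - Ξ) +
      (matrixGaussianPDF 1 Ξ z * (2 * frobInner (z - Ξ) (G z)) +
        matrixGaussianPDF 1 Ξ z * (sqNorm (G z) + κ z)) := .of_forall fun z => by
    simp only [Pi.zero_apply]
    rw [← eF]
    exact mul_nonneg (hφ0 z) (hF0 z)
  refine (ofReal_integral_eq_lintegral_ofReal iT hT0).symm.le.trans (ENNReal.ofReal_le_ofReal ?_)
  simp only [Pi.add_apply]
  have hsum := integral_add iX (iI.add iS)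
  have hsum2 := integral_add iI iS
  have hsum3 := integral_add iD iS
  simp only [Pi.add_apply] at hsum hsum2 hsum3
  -- Stein's identity trades the cross term for the divergence, after which the pointwise hypothesis
  -- `hC` can be integrated against the density.
  rw [hsum, eX, hsum2, hstein, ← hsum3]
  refine add_le_add_right ?_ _
  calc _ ≤ ∫ z : Fin m → Fin p → ℂ, matrixGaussianPDF 1 Ξ z * C := by
        refine integral_mono (iD.add iS) (iφ.mul_const _) fun z => ?_
        beta_reduce
        rw [← mul_add]
        refine mul_le_mul_of_nonneg_left ?_ (hφ0 z)
        have := hC z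
        linarith
    _ = C := by rw [integral_mul_const, eφ, one_mul]

end Stein

/-! ### Simplicity and positivity of the spectrum almost everywhere. -/

section GenericSpectrum

open Filter Topology Polynomial

variable {m p : ℕ}

/-- The determinant of the Hankel matrix of power sums of eigenvalues. -/
def hankelDet {R : Type*} [CommRing R] (W : Matrix (Fin p) (Fin p) R) : R :=
  (Matrix.of fun a b : Fin p => (W ^ ((a : ℕ) + b + 1)).trace).det

/-- Used with polynomial evaluation: the determinant commutes with restricting to a point of a line.
-/
lemma map_hankelDet {R S : Type*} [CommRing R] [CommRing S] (f : R →+* S)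
    (W : Matrix (Fin p) (Fin p) R) : f (hankelDet W) = hankelDet (f.mapMatrix W) := by
  rw [hankelDet, hankelDet, RingHom.map_det]
  congr 1
  ext a b
  simp only [RingHom.mapMatrix_apply, Matrix.map_apply, Matrix.of_apply]
  rw [← RingHom.mapMatrix_apply, ← map_pow, RingHom.mapMatrix_apply, AddMonoidHom.map_trace]

/-- The traces are power sums, so the Hankel matrix factors as `Vᵀ * diagonal l * V` with `V`
Vandermonde. One polynomial in the entries of `W` thus detects both vanishing and coinciding
eigenvalues. -/
lemma hankelDet_eq {W U : Matrix (Fin p) (Fin p) ℂ} {l : Fin p → ℂ}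
    (hU : U ∈ Matrix.unitaryGroup (Fin p) ℂ) (hW : W = U * Matrix.diagonal l * Uᴴ) :
    hankelDet W = (∏ k, l k) * (Matrix.vandermonde l).det ^ 2 := by
  have h1 : ∀ n : ℕ, W ^ n = U * Matrix.diagonal l ^ n * Uᴴ := by
    intro n
    induction n with
    | zero => simp [mul_conjTranspose_self_of_unitary hU]
    | succ n ih =>
      rw [pow_succ, ih, hW, pow_succ]
      have : U * Matrix.diagonal l ^ n * Uᴴ * (U * Matrix.diagonal l * Uᴴ) =
          U * Matrix.diagonal l ^ n * (Uᴴ * U) * Matrix.diagonal l * Uᴴ := by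
        simp only [Matrix.mul_assoc]
      rw [this, conjTranspose_mul_self_of_unitary hU, Matrix.mul_one]
      simp only [Matrix.mul_assoc]
  have h2 : ∀ n : ℕ, (W ^ n).trace = ∑ k, l k ^ n := by
    intro n
    rw [h1, Matrix.trace_mul_comm, ← Matrix.mul_assoc, conjTranspose_mul_self_of_unitary hU,
      Matrix.one_mul, Matrix.diagonal_pow, Matrix.trace_diagonal]
    rfl
  have h3 : (Matrix.of fun a b : Fin p => (W ^ ((a : ℕ) + b + 1)).trace) =
      (Matrix.vandermonde l)ᵀ * Matrix.diagonal l * Matrix.vandermonde l := by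
    ext a b
    rw [Matrix.of_apply, h2, Matrix.mul_apply]
    refine Finset.sum_congr rfl fun k _ => ?_
    rw [Matrix.mul_diagonal, Matrix.transpose_apply, Matrix.vandermonde_apply,
      Matrix.vandermonde_apply]
    ring
  rw [hankelDet, h3, Matrix.det_mul, Matrix.det_mul, Matrix.det_transpose, Matrix.det_diagonal]
  ring

lemma hankelDet_ne_zero_iff {W U : Matrix (Fin p) (Fin p) ℂ} {l : Fin p → ℂ}
    (hU : U ∈ Matrix.unitaryGroup (Fin p) ℂ) (hW : W = U * Matrix.diagonal l * Uᴴ) :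
    hankelDet W ≠ 0 ↔ (∀ k, l k ≠ 0) ∧ Function.Injective l := by
  rw [hankelDet_eq hU hW, mul_ne_zero_iff, pow_ne_zero_iff two_ne_zero, Finset.prod_ne_zero_iff,
    Matrix.det_vandermonde_ne_zero_iff]
  simp

/-- Along a line, the Hankel determinant of `zᴴ * z` is a polynomial. -/
lemma exists_polynomial_hankelDet (z v : Matrix (Fin m) (Fin p) ℂ) :
    ∃ P : ℂ[X], ∀ t : ℝ, P.eval (t : ℂ) = hankelDet ((z + t • v)ᴴ * (z + t • v)) := by
  let Q : Matrix (Fin p) (Fin p) ℂ[X] :=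
    (zᴴ * z).map C + (X : ℂ[X]) • (gramDeriv z v).map C + (X ^ 2 : ℂ[X]) • (vᴴ * v).map C
  refine ⟨hankelDet Q, fun t => ?_⟩
  rw [← Polynomial.coe_evalRingHom, map_hankelDet]
  congr 1
  have h := gram_add_smul_sub z v t
  rw [sub_eq_iff_eq_add] at h
  rw [h]
  ext a b
  simp only [Q, RingHom.mapMatrix_apply, Matrix.map_apply, Matrix.add_apply, Matrix.smul_apply,
    Polynomial.coe_evalRingHom, Polynomial.eval_add, Polynomial.eval_C, smul_eq_mul,
    Polynomial.eval_mul, Polynomial.eval_X, Polynomial.eval_pow, Complex.real_smul]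
  ring

/-- A rectangular matrix with distinct positive diagonal entries and zeros elsewhere. -/
def diagonalModel (m p : ℕ) : Matrix (Fin m) (Fin p) ℂ :=
  Matrix.of fun i j => if (i : ℕ) = j then ((j : ℕ) + 1 : ℂ) else 0

lemma gram_diagonalModel (hmp : p ≤ m) : (diagonalModel m p)ᴴ * diagonalModel m p =
    Matrix.diagonal fun k : Fin p => (((k : ℕ) : ℂ) + 1) ^ 2 := by
  ext j k
  rw [Matrix.mul_apply, Finset.sum_eq_single (Fin.castLE hmp j)]
  · by_cases hjk : j = k
    · subst hjk
      simp [diagonalModel, sq]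
    · have : (j : ℕ) ≠ k := fun h => hjk (Fin.ext h)
      simp [diagonalModel, hjk, this]
  · intro i _ hi
    have : (i : ℕ) ≠ j := fun h => hi (Fin.ext h)
    simp [diagonalModel, this]
  · simp

lemma hankelDet_gram_diagonalModel (hmp : p ≤ m) :
    hankelDet ((diagonalModel m p)ᴴ * diagonalModel m p) ≠ 0 := by
  rw [gram_diagonalModel hmp, hankelDet_ne_zero_iff (U := 1) (one_mem _)
    (l := fun k : Fin p => (((k : ℕ) : ℂ) + 1) ^ 2) (by simp)]
  refine ⟨fun k => pow_ne_zero _ (Nat.cast_add_one_ne_zero _), fun j k hjk => ?_⟩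
  have hjk' : (((j : ℕ) : ℂ) + 1) ^ 2 = (((k : ℕ) : ℂ) + 1) ^ 2 := hjk
  have h : (((j : ℕ) + 1) ^ 2 : ℕ) = ((k : ℕ) + 1) ^ 2 := by exact_mod_cast hjk'
  have := Nat.pow_left_injective two_ne_zero h
  exact Fin.ext (by omega)

variable {U : Matrix (Fin m) (Fin p) ℂ → Matrix (Fin p) (Fin p) ℂ}
  {ℓ : Matrix (Fin m) (Fin p) ℂ → Fin p → ℝ}

lemma hankelDet_gram_smul_ne_zero
    (hUℓ : ∀ z : Matrix (Fin m) (Fin p) ℂ, IsOrderedSpectralDecomposition (zᴴ * z) (U z) (ℓ z))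
    {s : ℝ} (hs : s ≠ 0) {z : Matrix (Fin m) (Fin p) ℂ} (hz : hankelDet (zᴴ * z) ≠ 0) :
    hankelDet ((s • z)ᴴ * (s • z)) ≠ 0 := by
  have h := hUℓ z
  rw [hankelDet_ne_zero_iff h.unitary h.eq] at hz
  have hs' : (s : ℂ) ^ 2 ≠ 0 := pow_ne_zero _ (Complex.ofReal_ne_zero.2 hs)
  have e : (s • z)ᴴ * (s • z) =
      U z * Matrix.diagonal (fun k => (s : ℂ) ^ 2 * (ℓ z k : ℂ)) * (U z)ᴴ := by
    have e1 : (s • z)ᴴ * (s • z) = ((s : ℂ) ^ 2) • (zᴴ * z) := by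
      ext i j
      simp only [Matrix.conjTranspose_smul, Matrix.smul_mul, Matrix.mul_smul, star_trivial,
        Matrix.smul_apply, Complex.real_smul, smul_eq_mul]
      ring
    have e2 : Matrix.diagonal (fun k => (s : ℂ) ^ 2 * (ℓ z k : ℂ)) =
        ((s : ℂ) ^ 2) • Matrix.diagonal fun k => (ℓ z k : ℂ) := by
      rw [← Matrix.diagonal_smul]; rfl
    rw [e1, e2, Matrix.mul_smul, Matrix.smul_mul, ← h.eq]
  rw [hankelDet_ne_zero_iff h.unitary e]
  exact ⟨fun k => mul_ne_zero hs' (hz.1 k), fun j k hjk => hz.2 (mul_left_cancel₀ hs' hjk)⟩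

/-- For small nonzero `s` the matrix `diagonalModel m p + s • z` is close to the model, where the
determinant is nonzero. Rescaling by `s⁻¹` puts it on the line through `z` and preserves
nonvanishing. -/
lemma exists_hankelDet_line_ne_zero (hmp : p ≤ m)
    (hUℓ : ∀ z : Matrix (Fin m) (Fin p) ℂ, IsOrderedSpectralDecomposition (zᴴ * z) (U z) (ℓ z))
    (z : Matrix (Fin m) (Fin p) ℂ) : ∃ t : ℝ,
      hankelDet ((z + t • diagonalModel m p)ᴴ * (z + t • diagonalModel m p)) ≠ 0 := by
  obtain ⟨P, hP⟩ := exists_polynomial_hankelDet (diagonalModel m p) z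
  have h0 : P.eval ((0 : ℝ) : ℂ) ≠ 0 := by
    rw [hP]
    simpa using hankelDet_gram_diagonalModel hmp
  have hc : Continuous fun t : ℝ => P.eval (t : ℂ) := P.continuous.comp Complex.continuous_ofReal
  have h1 : ∀ᶠ t : ℝ in 𝓝[≠] 0, P.eval (t : ℂ) ≠ 0 :=
    ((hc.tendsto 0).eventually_ne h0).filter_mono nhdsWithin_le_nhds
  obtain ⟨s, hs, hs0⟩ := (h1.and self_mem_nhdsWithin).exists
  have hs0 : s ≠ 0 := hs0
  refine ⟨s⁻¹, ?_⟩
  have e : z + s⁻¹ • diagonalModel m p = s⁻¹ • (diagonalModel m p + s • z) := by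
    rw [smul_add, smul_smul, inv_mul_cancel₀ hs0, one_smul, add_comm]
  rw [e]
  refine hankelDet_gram_smul_ne_zero hUℓ (inv_ne_zero hs0) ?_
  rw [← hP]
  exact hs

lemma continuous_hankelDet_gram :
    Continuous fun z : Matrix (Fin m) (Fin p) ℂ => hankelDet (zᴴ * z) := by
  refine Continuous.matrix_det (continuous_matrix fun a b => ?_)
  exact (continuous_gram.pow _).matrix_trace

/-- Almost every matrix has distinct positive singular values. -/
lemma ae_isSimplePos (hmp : p ≤ m)
    (hUℓ : ∀ z : Matrix (Fin m) (Fin p) ℂ, IsOrderedSpectralDecomposition (zᴴ * z) (U z) (ℓ z)) :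
    ∀ᵐ z : Fin m → Fin p → ℂ, IsSimplePos (ℓ z) := by
  let D : Matrix (Fin m) (Fin p) ℂ → ℂ := fun z => hankelDet (zᴴ * z)
  have hopen : IsOpen {z : Fin m → Fin p → ℂ | D z ≠ 0} :=
    isOpen_ne.preimage continuous_hankelDet_gram
  -- Fubini along lines parallel to `diagonalModel m p`: on each the determinant is a nonzero
  -- polynomial in `t`, so it vanishes at finitely many points.
  have h := ae_mem_of_ae_add_linearMap_mem
    (LinearMap.toSpanSingleton ℝ (Fin m → Fin p → ℂ) (diagonalModel m p)) volume
    (volume : Measure (Fin m → Fin p → ℂ)) hopen.measurableSet fun z => by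
      obtain ⟨P, hP⟩ := exists_polynomial_hankelDet z (diagonalModel m p)
      obtain ⟨t₀, ht₀⟩ := exists_hankelDet_line_ne_zero hmp hUℓ z
      have hP0 : P ≠ 0 := fun h => ht₀ (by rw [← hP, h, Polynomial.eval_zero])
      have hfin : {t : ℝ | P.eval (t : ℂ) = 0}.Finite := by
        have := (P.roots.toFinset.finite_toSet).preimage
          (Complex.ofReal_injective.injOn (s := (Complex.ofReal) ⁻¹' (P.roots.toFinset : Set ℂ)))
        refine this.subset fun t ht => ?_
        simpa [hP0] using ht
      have hz := hfin.measure_zero volume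
      rw [ae_iff]
      refine measure_mono_null (fun t ht => ?_) hz
      exact (hP t).trans (not_not.1 ht)
  filter_upwards [h] with z hz
  have hs := hUℓ z
  have hz' := (hankelDet_ne_zero_iff hs.unitary hs.eq).1 hz
  refine ⟨hs.antitone.strictAnti_of_injective fun j k hjk => hz'.2 (by simp only [hjk]), fun k => ?_⟩
  exact (eigenvalue_nonneg hs k).lt_of_ne' (Complex.ofReal_ne_zero.1 (hz'.1 k))

end GenericSpectrum

/-! ### Removal of the cutoff and conclusion. -/

section Minimax

open Filter Topology

variable {m p : ℕ} {U : Matrix (Fin m) (Fin p) ℂ → Matrix (Fin p) (Fin p) ℂ}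
  {ℓ : Matrix (Fin m) (Fin p) ℂ → Fin p → ℝ}

/-- The numerators of the shrinkage weights. -/
def shrinkCoeff (m p : ℕ) (k : Fin p) : ℝ := m + p - 2 * ((k : ℕ) + 1)

/-- The correction made by the shrinkage estimator. -/
def shrinkCorrection (U : Matrix (Fin m) (Fin p) ℂ → Matrix (Fin p) (Fin p) ℂ)
    (ℓ : Matrix (Fin m) (Fin p) ℂ → Fin p → ℝ) (z : Matrix (Fin m) (Fin p) ℂ) :
    Matrix (Fin m) (Fin p) ℂ :=
  z * specFun (shrinkCoeff m p) (U z) (ℓ z)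

lemma shrinkageEstimator_eq (z : Matrix (Fin m) (Fin p) ℂ) :
    shrinkageEstimator (shrinkageWeight m p) U ℓ z = z + shrinkCorrection U ℓ z := by
  rw [shrinkageEstimator, sum_specProj_smul, Matrix.mul_add, Matrix.mul_one]
  rfl

lemma tendsto_shrinkField {z : Matrix (Fin m) (Fin p) ℂ} (hz : IsSimplePos (ℓ z)) :
    Tendsto (fun n : ℕ => shrinkField (n + 1 : ℝ) (shrinkCoeff m p) U ℓ z) atTop
      (𝓝 (shrinkCorrection U ℓ z)) := by
  have h := (Complex.continuous_ofReal.tendsto _).comp (tendsto_cutoff hz)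
  have h2 := h.smul_const (shrinkCorrection U ℓ z)
  rw [Complex.ofReal_one, one_smul] at h2
  exact h2

/-- No measurability of `U` is assumed: the correction is an almost everywhere limit of the
continuous truncated fields. -/
lemma isEstimator_shrinkageEstimator (hmp : p < m)
    (hUℓ : ∀ z : Matrix (Fin m) (Fin p) ℂ, IsOrderedSpectralDecomposition (zᴴ * z) (U z) (ℓ z)) :
    IsEstimator (shrinkageEstimator (shrinkageWeight m p) U ℓ) := by
  rw [isEstimator_iff]
  let G : ℕ → (Fin m → Fin p → ℂ) → Fin m → Fin p → ℂ := fun n z =>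
    shrinkField (n + 1 : ℝ) (shrinkCoeff m p) U ℓ z
  have hG : ∀ n, Continuous (G n) := fun n =>
    continuous_shrinkField hUℓ (by positivity : (0 : ℝ) < n + 1) _
  refine aemeasurable_of_tendsto_metrizable_ae atTop (f := fun n z => z + G n z)
    (fun n => (continuous_id.add (hG n)).measurable.aemeasurable) ?_
  filter_upwards [ae_isSimplePos hmp.le hUℓ] with z hz
  let w : Fin m → Fin p → ℂ := shrinkCorrection U ℓ z
  have h : Tendsto (fun n => G n z) atTop (𝓝 w) := tendsto_shrinkField hz
  exact (congrArg 𝓝 (shrinkageEstimator_eq (U := U) (ℓ := ℓ) z)).symm ▸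
    (tendsto_const_nhds (x := z)).add h

/-- The risk improvement of the shrinkage estimator is at least `E [1 / (1 + ‖Z‖²)]`. -/
lemma risk_shrinkageEstimator_add_le (hp : 1 ≤ p) (hmp : p < m)
    (hUℓ : ∀ z : Matrix (Fin m) (Fin p) ℂ, IsOrderedSpectralDecomposition (zᴴ * z) (U z) (ℓ z))
    (Ξ : Fin m → Fin p → ℂ) :
    risk (shrinkageEstimator (shrinkageWeight m p) U ℓ) Ξ +
      ∫⁻ z, ENNReal.ofReal (1 / (1 + sqNorm z)) ∂matrixGaussian 1 Ξ ≤ ENNReal.ofReal (m * p) := by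
  set c := shrinkCoeff m p with hc
  let G : ℕ → (Fin m → Fin p → ℂ) → Fin m → Fin p → ℂ := fun n z =>
    shrinkField (n + 1 : ℝ) c U ℓ z
  let κ : ℕ → (Fin m → Fin p → ℂ) → ℝ := fun n z =>
    cutoff (n + 1 : ℝ) (ℓ z) * (1 / (1 + sqNorm z))
  have hpos : ∀ n : ℕ, (0 : ℝ) < n + 1 := fun n => by positivity
  have hN : ∀ z : Fin m → Fin p → ℂ, (0 : ℝ) < 1 + sqNorm z := fun z => by
    have := sqNorm_nonneg z
    positivity
  have hG : ∀ n, Continuous (G n) := fun n => continuous_shrinkField hUℓ (hpos n) c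
  have hN' : Continuous fun z : Fin m → Fin p → ℂ => 1 / (1 + sqNorm z) :=
    continuous_const.div (continuous_const.add continuous_sqNorm) fun z => (hN z).ne'
  have hκ : ∀ n, Continuous (κ n) := fun n =>
    ((contDiff_cutoff _).continuous.comp (continuous_eigenvalue hUℓ)).mul hN'
  have hbound : ∀ n, ∫⁻ z, ENNReal.ofReal (sqNorm (z - Ξ + G n z) + κ n z) ∂matrixGaussian 1 Ξ ≤
      ENNReal.ofReal (m * p + 4 * (∑ k, c k) / (n + 1)) := fun n =>
    lintegral_le_of_unbiased_risk_estimate_le Ξ (G := G n)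
      (G' := fun v z => shrinkFieldDeriv (n + 1 : ℝ) c U ℓ v z) (r := n + 1) (hG n)
      (fun v => continuous_shrinkFieldDeriv hUℓ (hpos n) c v) (hκ n)
      (fun z hz => shrinkField_eq_zero hUℓ (hpos n) c hz)
      (fun v z hz => shrinkFieldDeriv_eq_zero hUℓ (hpos n) c v hz)
      (fun z hz => mul_eq_zero_of_left (cutoff_eq_zero_of_norm_le hUℓ (hpos n) hz).1 _)
      (fun z => mul_nonneg (cutoff_nonneg _ _) (one_div_pos.2 (hN z)).le)
      (fun v z i j => hasDerivAt_shrinkField hUℓ (hpos n) c v z i j)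
      (fun z => sqNorm_shrinkField_add_realDiv_le hp hmp hUℓ (hpos n) (fun _ => rfl) z)
  let δ : (Fin m → Fin p → ℂ) → Fin m → Fin p → ℂ :=
    shrinkageEstimator (shrinkageWeight m p) U ℓ
  let f : (Fin m → Fin p → ℂ) → ℝ≥0∞ := fun z => ENNReal.ofReal (sqNorm (δ z - Ξ))
  have hlim : ∀ᵐ z ∂matrixGaussian 1 Ξ, f z + ENNReal.ofReal (1 / (1 + sqNorm z)) =
      liminf (fun n => ENNReal.ofReal (sqNorm (z - Ξ + G n z) + κ n z)) atTop := by
    filter_upwards [matrixGaussian_absolutelyContinuous_volume 1 Ξ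
      (ae_isSimplePos hmp.le hUℓ)] with z hz
    let w : Fin m → Fin p → ℂ := shrinkCorrection U ℓ z
    have h1 : Tendsto (fun n => G n z) atTop (𝓝 w) := tendsto_shrinkField hz
    have h2 : Tendsto (fun n => κ n z) atTop (𝓝 (1 * (1 / (1 + sqNorm z)))) :=
      (tendsto_cutoff hz).mul_const _
    have h3 : Tendsto (fun n => sqNorm (z - Ξ + G n z)) atTop
        (𝓝 (sqNorm (z - Ξ + w))) :=
      (continuous_sqNorm.tendsto _).comp (tendsto_const_nhds.add h1)
    rw [(ENNReal.tendsto_ofReal (h3.add h2)).liminf_eq, one_mul,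
      ENNReal.ofReal_add (sqNorm_nonneg _) (one_div_pos.2 (hN z)).le]
    have e : δ z = z + w := shrinkageEstimator_eq z
    change ENNReal.ofReal (sqNorm (δ z - Ξ)) + _ = _
    rw [e, add_sub_right_comm]
  have hrisk : risk (shrinkageEstimator (shrinkageWeight m p) U ℓ) Ξ =
      ∫⁻ z, f z ∂matrixGaussian 1 Ξ := risk_eq _ _
  rw [hrisk, ← lintegral_add_right _ hN'.measurable.ennreal_ofReal, lintegral_congr_ae hlim]
  -- Fatou's lemma suffices because only an upper bound on the risk is wanted; the untruncated field
  -- need not be shown square integrable.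
  refine (lintegral_liminf_le fun n => ?_).trans ?_
  · exact ((continuous_sqNorm.comp ((continuous_id.sub continuous_const).add (hG n))).add
      (hκ n)).measurable.ennreal_ofReal
  · have ht : Tendsto (fun n : ℕ => ENNReal.ofReal (m * p + 4 * (∑ k, c k) / (n + 1))) atTop
        (𝓝 (ENNReal.ofReal (m * p))) := by
      refine ENNReal.tendsto_ofReal ?_
      have hn : Tendsto (fun n : ℕ => (n + 1 : ℝ)) atTop atTop :=
        tendsto_atTop_add_const_right _ _ tendsto_natCast_atTop_atTop
      have := (tendsto_const_nhds (x := (m : ℝ) * p)).add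
        ((tendsto_const_nhds (x := 4 * ∑ k, c k)).div_atTop hn)
      rwa [add_zero] at this
    rw [← ht.liminf_eq]
    exact liminf_le_liminf (.of_forall hbound)

/-- The gain has a positive integral because its integrand is positive everywhere. Finiteness of the
risk is needed for adding a positive amount to be strict in `ℝ≥0∞`. -/
lemma risk_shrinkageEstimator_lt (hp : 1 ≤ p) (hmp : p < m)
    (hUℓ : ∀ z : Matrix (Fin m) (Fin p) ℂ, IsOrderedSpectralDecomposition (zᴴ * z) (U z) (ℓ z))
    (Ξ : Fin m → Fin p → ℂ) :
    risk (shrinkageEstimator (shrinkageWeight m p) U ℓ) Ξ < ENNReal.ofReal (m * p) := by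
  have h := risk_shrinkageEstimator_add_le hp hmp hUℓ Ξ
  have hN' : Continuous fun z : Fin m → Fin p → ℂ => 1 / (1 + sqNorm z) :=
    continuous_const.div (continuous_const.add continuous_sqNorm) fun z => by
      have := sqNorm_nonneg z
      positivity
  have hpos : ∫⁻ z, ENNReal.ofReal (1 / (1 + sqNorm z)) ∂matrixGaussian 1 Ξ ≠ 0 := by
    intro h0
    rw [lintegral_eq_zero_iff hN'.measurable.ennreal_ofReal] at h0
    have hprob := isProbabilityMeasure_matrixGaussian one_pos Ξ
    obtain ⟨z, hz⟩ := h0.exists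
    have := sqNorm_nonneg z
    simp only [Pi.zero_apply, ENNReal.ofReal_eq_zero] at hz
    exact absurd hz (not_le.2 (by positivity))
  have htop : risk (shrinkageEstimator (shrinkageWeight m p) U ℓ) Ξ ≠ ⊤ :=
    ne_top_of_le_ne_top ENNReal.ofReal_ne_top (le_self_add.trans h)
  exact (ENNReal.lt_add_right htop hpos).trans_le h

end Minimax

end

theorem mainTheorem7 (m p : ℕ) (hp : 1 ≤ p) (hmp : p < m)
    (U : Matrix (Fin m) (Fin p) ℂ → Matrix (Fin p) (Fin p) ℂ)
    (ℓ : Matrix (Fin m) (Fin p) ℂ → Fin p → ℝ)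
    (hUℓ : ∀ z : Matrix (Fin m) (Fin p) ℂ,
      IsOrderedSpectralDecomposition (zᴴ * z) (U z) (ℓ z)) :
    IsMinimax (shrinkageEstimator (shrinkageWeight m p) U ℓ) ∧
      ∀ Ξ : Matrix (Fin m) (Fin p) ℂ,
        risk (shrinkageEstimator (shrinkageWeight m p) U ℓ) Ξ < risk (fun z => z) Ξ := by
  refine ⟨⟨isEstimator_shrinkageEstimator hmp hUℓ, fun δ' hδ' => ?_⟩, fun Ξ => ?_⟩
  · exact (iSup_le fun Ξ => (risk_shrinkageEstimator_lt hp hmp hUℓ Ξ).le).trans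
      (mul_le_iSup_risk hδ')
  · rw [risk_id]
    exact risk_shrinkageEstimator_lt hp hmp hUℓ Ξ
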